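/- **Definitions.** Fix effective numberings of $\mathbb{Q}$ and of $\mathbb{Q}_{>0}=\{q_0,q_1,\dots\}$. A *computable metric space* is a complete metric space $(X,d)$ with a dense sequence $(s_i)_{i\in\mathbb{N}}$ of points (the *ideal points*) such that the real numbers $d(s_i,s_j)$ are computable uniformly in $i,j$. Its *ideal balls* are $B_{\langle i,j\rangle}=B(s_i,q_j)$. A point $x\in X$ is *computable* if $\{n: x\in B_n\}$ is recursively enumerable (r.e.). Sets $U_0,U_1,\dots\subseteq X$ are *uniformly r.e. open* if $U_k=\bigcup_{n\in E_k}B_n$ for sets $E_k\subseteq\mathbb{N}$ that are r.e. uniformly in $k$. A *constructive $G_\delta$-set* is the intersection of a sequence of uniformly r.e. open sets. A *computable probability space* (CPS) is a pair $(X,\mu)$ where $X$ is a computable metric space and $\mu$ is a Borel probability measure on $X$ which is a computable point of the space of Borel probability measures on $X$ with the Prokhorov metric, the ideal points being the (effectively numbered) probability measures that are concentrated on finitely many ideal points of $X$ and give them rational weights. A *morphism* of CPSs $F:(X,\mu)\to(Y,\nu)$ is a function $F:D_F\to Y$, where $D_F\subseteq X$ is a constructive $G_\delta$-set with $\mu(D_F)=1$,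 such that - $F$ is computable on $D_F$: there are uniformly r.e. open sets $U_n\subseteq X$ with $F^{-1}(B^Y_n)=U_n\cap D_F$ for all $n$, where $B^Y_0,B^Y_1,\dots$ are the ideal balls of $Y$; and - $F$ is measure-preserving: $\mu(F^{-1}(A))=\nu(A)$ for every Borel set $A\subseteq Y$. An *isomorphism* of CPSs between $(X,\mu)$ and $(Y,\nu)$ is a pair of morphisms $F:(X,\mu)\to(Y,\nu)$ and $G:(Y,\nu)\to(X,\mu)$ such that $G\circ F=\mathrm{id}$ on $F^{-1}(D_G)$ and $F\circ G=\mathrm{id}$ on $G^{-1}(D_F)$. A *computable Lebesgue space* is a CPS that is isomorphic to the CPS $([0,1],m)$, where $[0,1]$ has the usual metric and the rational points of $[0,1]$, in an effective numbering, as ideal points, and $m$ is Lebesgue measure. **Theorem.** Every computable probability space $(X,\mu)$ with no atoms (that is, $\mu(\{x\})=0$ for all $x\in X$) is a computable Lebesgue space. -/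

import Mathlib

open MeasureTheory
open scoped ENNReal

namespace CompProb

/-! ### Rational numbers, computable reals -/

/-- An effective numbering of the rationals: the code of `(a - b) / (c + 1)` is
`⟨⟨a, b⟩, c⟩`. -/
def ratOf (n : ℕ) : ℚ :=
  ((n.unpair.1.unpair.1 : ℚ) - (n.unpair.1.unpair.2 : ℚ)) / ((n.unpair.2 : ℚ) + 1)

/-- An effective numbering of the positive rationals: the code of `(a + 1) / (b + 1)` is
`⟨a, b⟩`. -/
def posRatOf (n : ℕ) : ℚ :=
  ((n.unpair.1 : ℚ) + 1) / ((n.unpair.2 : ℚ) + 1)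

/-- The double sequence `x` of reals is computable, uniformly in its two indices. -/
def UniformlyComputableReal (x : ℕ → ℕ → ℝ) : Prop :=
  ∃ φ : (ℕ × ℕ) × ℕ → ℕ, Computable φ ∧
    ∀ i j n : ℕ, |x i j - (ratOf (φ ((i, j), n)) : ℝ)| < (2 : ℝ)⁻¹ ^ n

/-! ### Computable metric spaces -/

/-- `(X, d, s)` is a computable metric space with ideal points `s 0, s 1, …`. -/
structure IsComputableMetricSpace {X : Type*} [MetricSpace X] (s : ℕ → X) : Prop where
  complete : CompleteSpace X
  dense : DenseRange s
  dist_computable : UniformlyComputableReal fun i j => dist (s i) (s j)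

/-- The ideal ball with code `⟨i, j⟩`: center `s i`, radius the `j`-th positive rational. -/
def idealBall {X : Type*} [PseudoMetricSpace X] (s : ℕ → X) (n : ℕ) : Set X :=
  Metric.ball (s n.unpair.1) (posRatOf n.unpair.2 : ℝ)

/-- `x` is a computable point: the set of the ideal balls containing `x` is r.e. -/
def IsComputablePoint {X : Type*} [PseudoMetricSpace X] (s : ℕ → X) (x : X) : Prop :=
  REPred fun n : ℕ => x ∈ idealBall s n

/-- The sets `U 0, U 1, …` are r.e. open, uniformly. -/
def UniformlyREOpen {X : Type*} [PseudoMetricSpace X] (s : ℕ → X) (U : ℕ → Set X) : Prop :=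
  ∃ E : ℕ → Set ℕ, (REPred fun p : ℕ × ℕ => p.2 ∈ E p.1) ∧
    ∀ i, U i = ⋃ n ∈ E i, idealBall s n

/-- `D` is a constructive `G_δ` set: an intersection of uniformly r.e. open sets. -/
def IsConstructiveGδ {X : Type*} [PseudoMetricSpace X] (s : ℕ → X) (D : Set X) : Prop :=
  ∃ U : ℕ → Set X, UniformlyREOpen s U ∧ D = ⋂ i, U i

/-- `F` is computable on `D`: the sets `F⁻¹(B_i)`, for `B_i` the ideal balls of `Y`, are
r.e. open in `D`, uniformly in `i`. Only the values of `F` on `D` matter. -/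
def ComputableOn {X Y : Type*} [PseudoMetricSpace X] [PseudoMetricSpace Y]
    (s : ℕ → X) (t : ℕ → Y) (F : X → Y) (D : Set X) : Prop :=
  ∃ U : ℕ → Set X, UniformlyREOpen s U ∧ ∀ i, D ∩ F ⁻¹' idealBall t i = U i ∩ D

/-! ### Computable probability measures -/

section measures

variable {X : Type*} [MeasurableSpace X]

/-- The uniform measure on a nonempty list of ideal points, given by their indices and counted
with multiplicity. These are exactly the probability measures that are concentrated on finitely
many ideal points and give them rational weights. -/
noncomputable def listMeasure (s : ℕ → X) (L : List ℕ) : Measure X :=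
  (L.length : ℝ≥0∞)⁻¹ • (L.map fun i => Measure.dirac (s i)).sum

/-- The `n`-th nonempty list of natural numbers. -/
def idealList (n : ℕ) : List ℕ :=
  n.unpair.1 :: Denumerable.ofNat (List ℕ) n.unpair.2

theorem sum_dirac_apply (s : ℕ → X) (L : List ℕ) {B : Set X} (hB : MeasurableSet B)
    [DecidablePred (· ∈ B)] :
    (L.map fun i => Measure.dirac (s i)).sum B = (L.filter fun i => decide (s i ∈ B)).length := by
  induction L with
  | nil => simp
  | cons a L ih =>
    simp only [List.map_cons, List.sum_cons, Measure.add_apply, ih, Measure.dirac_apply' _ hB]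
    by_cases h : s a ∈ B
    · simp [h, add_comm]
    · simp [h]

theorem isProbabilityMeasure_listMeasure (s : ℕ → X) {L : List ℕ} (hL : L ≠ []) :
    IsProbabilityMeasure (listMeasure s L) := by
  classical
  constructor
  have h0 : (L.length : ℝ≥0∞) ≠ 0 := by simpa using hL
  rw [listMeasure, Measure.smul_apply, sum_dirac_apply s L MeasurableSet.univ]
  simpa using ENNReal.inv_mul_cancel h0 (ENNReal.natCast_ne_top _)

/-- The numbered set of the ideal points of the space of probability measures over `X` with the
Prokhorov metric: the probability measures that are concentrated on finitely many ideal points of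
`X` and give them rational weights. -/
noncomputable def idealMeasure (s : ℕ → X) (n : ℕ) :
    LevyProkhorov (ProbabilityMeasure X) :=
  LevyProkhorov.ofMeasure
    ⟨listMeasure s (idealList n), isProbabilityMeasure_listMeasure s (List.cons_ne_nil _ _)⟩

end measures

/-- `μ` is a computable measure: a computable point of the space of probability measures over `X`
with the Prokhorov metric. -/
def IsComputableMeasure {X : Type*} [MetricSpace X] [MeasurableSpace X] [OpensMeasurableSpace X]
    (s : ℕ → X) (μ : ProbabilityMeasure X) : Prop :=
  IsComputablePoint (idealMeasure s) (LevyProkhorov.ofMeasure μ)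

/-! ### Computable probability spaces and their isomorphisms -/

/-- `(X, d, s, μ)` is a computable probability space. -/
structure IsComputableProbabilitySpace {X : Type*} [MetricSpace X] [MeasurableSpace X]
    [BorelSpace X] (s : ℕ → X) (μ : ProbabilityMeasure X) : Prop where
  metric : IsComputableMetricSpace s
  measure : IsComputableMeasure s μ

/-- A morphism of computable probability spaces: a partial function from `X` to `Y`, here the
restriction of `toFun` to `dom`, that is computable on its domain, a constructive `G_δ` set of
measure one, and that preserves the measure. -/
structure Morphism {X Y : Type*} [MetricSpace X] [MeasurableSpace X] [MetricSpace Y]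
    [MeasurableSpace Y] (s : ℕ → X) (μ : ProbabilityMeasure X)
    (t : ℕ → Y) (ν : ProbabilityMeasure Y) where
  toFun : X → Y
  dom : Set X
  dom_constructive : IsConstructiveGδ s dom
  dom_full : (μ : Measure X) dom = 1
  computableOn : ComputableOn s t toFun dom
  measure_preserving : ∀ A : Set Y, MeasurableSet A →
    (μ : Measure X) (dom ∩ toFun ⁻¹' A) = (ν : Measure Y) A

/-- An isomorphism of computable probability spaces: a pair `(F, G)` of morphisms with
`G ∘ F = id` on `F⁻¹(dom G)` and `F ∘ G = id` on `G⁻¹(dom F)`. -/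
structure Isomorphism {X Y : Type*} [MetricSpace X] [MeasurableSpace X] [BorelSpace X]
    [MetricSpace Y] [MeasurableSpace Y] [BorelSpace Y] (s : ℕ → X) (μ : ProbabilityMeasure X)
    (t : ℕ → Y) (ν : ProbabilityMeasure Y) where
  source : IsComputableProbabilitySpace s μ
  target : IsComputableProbabilitySpace t ν
  F : Morphism s μ t ν
  G : Morphism t ν s μ
  left_inv : ∀ x ∈ F.dom, F.toFun x ∈ G.dom → G.toFun (F.toFun x) = x
  right_inv : ∀ y ∈ G.dom, G.toFun y ∈ F.dom → F.toFun (G.toFun y) = y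

/-! ### The unit interval with Lebesgue measure -/

/-- The rational points of `[0, 1]`, numbered effectively: the point with code `⟨a, b⟩` is
`min (a / (b + 1)) 1`. -/
noncomputable def unitIdeal (n : ℕ) : unitInterval :=
  ⟨min ((n.unpair.1 : ℝ) / ((n.unpair.2 : ℝ) + 1)) 1,
    le_min (by positivity) zero_le_one, min_le_right _ _⟩

/-- Lebesgue measure on `[0, 1]`. -/
noncomputable def unitMeasure : ProbabilityMeasure unitInterval :=
  ⟨volume, inferInstance⟩

/-- A computable Lebesgue space: a computable probability space that is isomorphic to `[0, 1]`
with Lebesgue measure. -/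
def IsComputableLebesgueSpace {X : Type*} [MetricSpace X] [MeasurableSpace X] [BorelSpace X]
    (s : ℕ → X) (μ : ProbabilityMeasure X) : Prop :=
  Nonempty (Isomorphism s μ unitIdeal unitMeasure)

/-! ### `[0, 1]` with Lebesgue measure is a computable probability space

The definition of a computable Lebesgue space rests on this fact; the declarations of this section
only serve to prove it. -/

theorem rePred_exists {α : Type*} [Primcodable α] {R : α → ℕ → Prop} (h : PrimrecRel R) :
    REPred fun a => ∃ n, R a n := by
  obtain ⟨inst, hd⟩ := h
  have dec : ∀ a n, Decidable (R a n) := fun a n => inst (a, n)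
  have h2 : Partrec fun a => Nat.rfind fun n => Part.some (decide (R a n)) :=
    Partrec.rfind (Computable.partrec (f := fun p : α × ℕ => decide (R p.1 p.2))
      (hd.to_comp.of_eq fun p => by congr))
  refine h2.dom_re.of_eq fun a => ?_
  refine Nat.rfind_dom.trans ?_
  simp

theorem primrec_sublists : Primrec (fun L : List ℕ => L.sublists') := by
  have := Primrec.list_rec (α := List ℕ) (f := fun L => L) (g := fun _ => [([] : List ℕ)])
    (h := fun _ p => p.2.2 ++ p.2.2.map (List.cons p.1)) Primrec.id (Primrec.const _)
    (Primrec.list_append.comp (Primrec.snd.comp (Primrec.snd.comp Primrec.snd))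
      (Primrec.list_map (Primrec.snd.comp (Primrec.snd.comp Primrec.snd))
        (Primrec.list_cons.comp (Primrec.fst.comp (Primrec.snd.comp Primrec.fst)) Primrec.snd)))
  refine this.of_eq fun L => ?_
  induction L with
  | nil => rfl
  | cons a L ih => simp only [List.sublists'_cons, ← ih]

theorem primrec_idealList : Primrec idealList :=
  Primrec.list_cons.comp (Primrec.fst.comp Primrec.unpair)
    ((Primrec.ofNat (List ℕ)).comp (Primrec.snd.comp Primrec.unpair))

/-- The numerator of the `n`-th ideal point of `[0, 1]`. -/
def unitNum (n : ℕ) : ℕ := min n.unpair.1 (n.unpair.2 + 1)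

theorem coe_unitIdeal (n : ℕ) :
    (unitIdeal n : ℝ) = (unitNum n : ℝ) / ((n.unpair.2 : ℝ) + 1) := by
  have h : (0 : ℝ) < (n.unpair.2 : ℝ) + 1 := by positivity
  simp only [unitIdeal, unitNum, Nat.cast_min, Nat.cast_add, Nat.cast_one]
  rw [← min_div_div_right h.le, div_self h.ne']

/-- The cell `[k / N, (k + 1) / N]` is in the open ball of radius `e / N` around the `i`-th ideal
point. -/
def CellIn (i N e k : ℕ) : Prop :=
  (k + 1) * (i.unpair.2 + 1) < unitNum i * N + e * (i.unpair.2 + 1) ∧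
    unitNum i * N < k * (i.unpair.2 + 1) + e * (i.unpair.2 + 1)

instance (i N e k : ℕ) : Decidable (CellIn i N e k) := by unfold CellIn; infer_instance

/-- A finite certificate for `ρ(m, ν) < q`, for the `n.1`-th ideal measure `ν` and the `n.2`-th
positive rational `q`. -/
def Cert (n w : ℕ) : Prop :=
  w.unpair.2 * (n.unpair.2.unpair.2 + 1) < (n.unpair.2.unpair.1 + 1) * (w.unpair.1 + 1) ∧
  ∀ A ∈ (idealList n.unpair.1).sublists',
    A.length * (w.unpair.1 + 1) ≤
      (((List.range (w.unpair.1 + 1)).filter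
        fun k => ∃ i ∈ A, CellIn i (w.unpair.1 + 1) w.unpair.2 k).length + w.unpair.2) *
          (idealList n.unpair.1).length

theorem primrec_unitNum : Primrec unitNum :=
  Primrec.nat_min.comp (Primrec.fst.comp Primrec.unpair)
    (Primrec.succ.comp (Primrec.snd.comp Primrec.unpair))

theorem primrec_cellIn : PrimrecRel fun (i : ℕ) (p : (ℕ × ℕ) × ℕ) => CellIn i p.1.1 p.1.2 p.2 := by
  have hi : Primrec fun x : ℕ × ((ℕ × ℕ) × ℕ) => x.1 := Primrec.fst
  have hb : Primrec fun x : ℕ × ((ℕ × ℕ) × ℕ) => x.1.unpair.2 + 1 :=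
    Primrec.succ.comp (Primrec.snd.comp (Primrec.unpair.comp hi))
  have hu : Primrec fun x : ℕ × ((ℕ × ℕ) × ℕ) => unitNum x.1 := primrec_unitNum.comp hi
  have hN : Primrec fun x : ℕ × ((ℕ × ℕ) × ℕ) => x.2.1.1 :=
    Primrec.fst.comp (Primrec.fst.comp Primrec.snd)
  have he : Primrec fun x : ℕ × ((ℕ × ℕ) × ℕ) => x.2.1.2 :=
    Primrec.snd.comp (Primrec.fst.comp Primrec.snd)
  have hk : Primrec fun x : ℕ × ((ℕ × ℕ) × ℕ) => x.2.2 := Primrec.snd.comp Primrec.snd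
  have h1 := Primrec.nat_mul.comp hu hN
  have h2 := Primrec.nat_mul.comp he hb
  exact PrimrecPred.and
    (Primrec.nat_lt.comp (Primrec.nat_mul.comp (Primrec.succ.comp hk) hb)
      (Primrec.nat_add.comp h1 h2))
    (Primrec.nat_lt.comp h1 (Primrec.nat_add.comp (Primrec.nat_mul.comp hk hb) h2))

theorem primrec_cert : PrimrecRel Cert := by
  have hn : Primrec fun x : ℕ × ℕ => x.1.unpair := Primrec.unpair.comp Primrec.fst
  have hw : Primrec fun x : ℕ × ℕ => x.2.unpair := Primrec.unpair.comp Primrec.snd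
  have hN : Primrec fun x : ℕ × ℕ => x.2.unpair.1 + 1 := Primrec.succ.comp (Primrec.fst.comp hw)
  have he : Primrec fun x : ℕ × ℕ => x.2.unpair.2 := Primrec.snd.comp hw
  have hq : Primrec fun x : ℕ × ℕ => x.1.unpair.2.unpair :=
    Primrec.unpair.comp (Primrec.snd.comp hn)
  have hL : Primrec fun x : ℕ × ℕ => idealList x.1.unpair.1 :=
    primrec_idealList.comp (Primrec.fst.comp hn)
  refine PrimrecPred.and
    (Primrec.nat_lt.comp (Primrec.nat_mul.comp he (Primrec.succ.comp (Primrec.snd.comp hq)))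
      (Primrec.nat_mul.comp (Primrec.succ.comp (Primrec.fst.comp hq)) hN)) ?_
  have hcell : PrimrecRel fun (k : ℕ) (p : List ℕ × (ℕ × ℕ)) =>
      ∃ i ∈ p.1, CellIn i p.2.1 p.2.2 k :=
    (primrec_cellIn.exists_mem_list.comp (Primrec.fst.comp Primrec.snd)
      (Primrec.pair (Primrec.snd.comp Primrec.snd) Primrec.fst) :
      PrimrecPred fun x : ℕ × (List ℕ × (ℕ × ℕ)) =>
        ∃ i ∈ x.2.1, CellIn i x.2.2.1 x.2.2.2 x.1)
  have hA : PrimrecRel fun (A : List ℕ) (y : (ℕ × ℕ) × ℕ) =>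
      A.length * y.1.1 ≤ (((List.range y.1.1).filter
        fun k => ∃ i ∈ A, CellIn i y.1.1 y.1.2 k).length + y.1.2) * y.2 := by
    have hy : Primrec fun x : List ℕ × ((ℕ × ℕ) × ℕ) => x.2.1 := Primrec.fst.comp Primrec.snd
    refine Primrec.nat_le.comp
      (Primrec.nat_mul.comp (Primrec.list_length.comp Primrec.fst) (Primrec.fst.comp hy))
      (Primrec.nat_mul.comp (Primrec.nat_add.comp (Primrec.list_length.comp ?_)
        (Primrec.snd.comp hy)) (Primrec.snd.comp Primrec.snd))
    exact hcell.listFilter.comp (Primrec.list_range.comp (Primrec.fst.comp hy))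
      (Primrec.pair Primrec.fst hy)
  exact hA.forall_mem_list.comp (primrec_sublists.comp hL)
    (Primrec.pair (Primrec.pair hN he) (Primrec.list_length.comp hL))

theorem cellIn_iff {i N e k : ℕ} (hN : 0 < N) :
    CellIn i N e k ↔ ((k : ℝ) + 1) / N < unitIdeal i + (e : ℝ) / N ∧
      (unitIdeal i : ℝ) < (k : ℝ) / N + (e : ℝ) / N := by
  have h1 : (0 : ℝ) < N := by exact_mod_cast hN
  have h2 : (0 : ℝ) < (i.unpair.2 : ℝ) + 1 := by positivity
  rw [CellIn, coe_unitIdeal, div_add_div _ _ h2.ne' h1.ne', ← add_div, div_lt_div_iff₀ h1 (by positivity),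
    div_lt_div_iff₀ h2 h1, ← @Nat.cast_lt ℝ, ← @Nat.cast_lt ℝ]
  push_cast
  refine and_congr ?_ ?_
  · rw [show ((k : ℝ) + 1) * (((i.unpair.2 : ℝ) + 1) * N) =
      (((k : ℝ) + 1) * ((i.unpair.2 : ℝ) + 1)) * N by ring, mul_lt_mul_iff_left₀ h1]
    ring_nf
  · ring_nf

theorem volume_cell_Ico {N k : ℕ} (hk : k < N) :
    volume {x : unitInterval | (k : ℝ) / N ≤ x ∧ (x : ℝ) < ((k : ℝ) + 1) / N} =
      ENNReal.ofReal (1 / N) := by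
  have h1 : (0 : ℝ) < N := by exact_mod_cast (Nat.zero_le k).trans_lt hk
  have h2 : (k : ℝ) + 1 ≤ N := by exact_mod_cast hk
  have := unitInterval.volume_Ico ⟨(k : ℝ) / N, by positivity, (div_le_one h1).2 (by linarith)⟩
    ⟨((k : ℝ) + 1) / N, by positivity, (div_le_one h1).2 h2⟩
  rw [show (1 : ℝ) / N = ((k : ℝ) + 1) / N - k / N by ring]
  exact this

theorem volume_cell_Icc {N k : ℕ} (hk : k < N) :
    volume {x : unitInterval | (k : ℝ) / N ≤ x ∧ (x : ℝ) ≤ ((k : ℝ) + 1) / N} =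
      ENNReal.ofReal (1 / N) := by
  have h1 : (0 : ℝ) < N := by exact_mod_cast (Nat.zero_le k).trans_lt hk
  have h2 : (k : ℝ) + 1 ≤ N := by exact_mod_cast hk
  have := unitInterval.volume_Icc ⟨(k : ℝ) / N, by positivity, (div_le_one h1).2 (by linarith)⟩
    ⟨((k : ℝ) + 1) / N, by positivity, (div_le_one h1).2 h2⟩
  rw [show (1 : ℝ) / N = ((k : ℝ) + 1) / N - k / N by ring]
  exact this

theorem length_filter_range (N : ℕ) (p : ℕ → Prop) [DecidablePred p] :
    ((List.range N).filter fun k => p k).length = ((Finset.range N).filter p).card := rfl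

theorem listMeasure_apply {X : Type*} [MeasurableSpace X] (s : ℕ → X) {L : List ℕ} (hL : L ≠ [])
    {B : Set X} (hB : MeasurableSet B) [DecidablePred (· ∈ B)] :
    listMeasure s L B =
      ENNReal.ofReal ((L.filter fun i => decide (s i ∈ B)).length / L.length) := by
  have h0 : (0 : ℝ) < L.length := by exact_mod_cast List.length_pos_iff.2 hL
  rw [listMeasure, Measure.smul_apply, sum_dirac_apply s L hB, ENNReal.ofReal_div_of_pos h0,
    ENNReal.ofReal_natCast, ENNReal.ofReal_natCast, smul_eq_mul, mul_comm, ENNReal.div_eq_inv_mul,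
    mul_comm]

theorem cert_sound {n w : ℕ} (h : Cert n w) :
    levyProkhorovDist (listMeasure unitIdeal (idealList n.unpair.1)) volume <
      (posRatOf n.unpair.2 : ℝ) := by
  classical
  obtain ⟨hq, hA⟩ := h
  set L := idealList n.unpair.1 with hL
  have hL0 : L ≠ [] := List.cons_ne_nil _ _
  have hℓ : (0 : ℝ) < L.length := by exact_mod_cast List.length_pos_iff.2 hL0
  have := isProbabilityMeasure_listMeasure unitIdeal hL0
  set N := w.unpair.1 + 1 with hNdef
  set e := w.unpair.2
  have hN0 : 0 < N := Nat.succ_pos _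
  have hN : (0 : ℝ) < N := by exact_mod_cast hN0
  refine lt_of_le_of_lt (b := (e : ℝ) / N)
    (levyProkhorovDist_le_of_forall_le _ _ (by positivity) fun ε B hε hB => ?_) ?_
  · rw [listMeasure_apply unitIdeal hL0 hB]
    have hc := hA (L.filter fun i => decide (unitIdeal i ∈ B))
      (List.mem_sublists'.2 List.filter_sublist)
    set A := L.filter fun i => decide (unitIdeal i ∈ B) with hAdef
    rw [length_filter_range] at hc
    set K := (Finset.range N).filter fun k => ∃ i ∈ A, CellIn i N e k with hK
    have hvol : ENNReal.ofReal (K.card / N) ≤ volume (Metric.thickening ε B) := by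
      calc ENNReal.ofReal (K.card / N)
          = ∑ k ∈ K, volume {x : unitInterval | (k : ℝ) / N ≤ x ∧ (x : ℝ) < ((k : ℝ) + 1) / N} := by
            rw [Finset.sum_congr rfl fun k hk => volume_cell_Ico
              (Finset.mem_range.1 (Finset.mem_filter.1 hk).1), Finset.sum_const, nsmul_eq_mul,
              div_eq_mul_one_div, ENNReal.ofReal_mul (by positivity), ENNReal.ofReal_natCast]
        _ = volume (⋃ k ∈ K, {x : unitInterval | (k : ℝ) / N ≤ x ∧ (x : ℝ) < ((k : ℝ) + 1) / N}) := by
            refine (measure_biUnion_finset ?_ fun k _ => ?_).symm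
            · intro a _ b _ hab
              refine Set.disjoint_left.2 fun x hxa hxb => hab ?_
              simp only [Set.mem_ofPred_eq, div_le_iff₀ hN, lt_div_iff₀ hN] at hxa hxb
              have h1 : a < b + 1 := by exact_mod_cast hxa.1.trans_lt hxb.2
              have h2 : b < a + 1 := by exact_mod_cast hxb.1.trans_lt hxa.2
              omega
            · exact (measurableSet_le measurable_const measurable_subtype_coe).inter
                (measurableSet_lt measurable_subtype_coe measurable_const)
        _ ≤ _ := by
            refine measure_mono (Set.iUnion₂_subset fun k hk x hx => ?_)
            obtain ⟨i, hi, hcell⟩ := (Finset.mem_filter.1 hk).2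
            have hiB : unitIdeal i ∈ B := by simpa using (List.mem_filter.1 hi).2
            obtain ⟨c1, c2⟩ := (cellIn_iff hN0).1 hcell
            refine Metric.mem_thickening_iff.2 ⟨_, hiB, ?_⟩
            rw [Subtype.dist_eq, Real.dist_eq, abs_lt]
            have := hx.1
            have := hx.2
            constructor <;> linarith
    refine le_trans ?_ (add_le_add hvol (ENNReal.ofReal_le_ofReal hε.le))
    rw [← ENNReal.ofReal_add (by positivity) (by positivity)]
    refine ENNReal.ofReal_le_ofReal ?_
    rw [← add_div, div_le_div_iff₀ hℓ hN]
    exact_mod_cast hc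
  · rw [posRatOf]
    push_cast
    rw [div_lt_div_iff₀ hN (by positivity)]
    exact_mod_cast hq

theorem cert_complete {n : ℕ}
    (h : levyProkhorovDist (listMeasure unitIdeal (idealList n.unpair.1)) volume <
      (posRatOf n.unpair.2 : ℝ)) : ∃ w, Cert n w := by
  classical
  set L := idealList n.unpair.1 with hL
  have hL0 : L ≠ [] := List.cons_ne_nil _ _
  have hℓ : (0 : ℝ) < L.length := by exact_mod_cast List.length_pos_iff.2 hL0
  have := isProbabilityMeasure_listMeasure unitIdeal hL0
  obtain ⟨q, hq1, hq2⟩ := exists_between h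
  have hq0 : 0 < q := lt_of_le_of_lt ENNReal.toReal_nonneg hq1
  have hE : levyProkhorovEDist (listMeasure unitIdeal L) volume < ENNReal.ofReal q :=
    (ENNReal.lt_ofReal_iff_toReal_lt (levyProkhorovEDist_ne_top _ _)).2 hq1
  obtain ⟨M, hM⟩ := exists_nat_gt (2 / ((posRatOf n.unpair.2 : ℝ) - q))
  have hMN : (2 : ℝ) / ((posRatOf n.unpair.2 : ℝ) - q) < ((M + 1 : ℕ) : ℝ) := by
    push_cast; linarith
  obtain ⟨N, hNM⟩ : ∃ N, N = M + 1 := ⟨_, rfl⟩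
  rw [← hNM] at hMN
  have hN0 : 0 < N := by omega
  have hN : (0 : ℝ) < N := by exact_mod_cast hN0
  rw [div_lt_iff₀ (by linarith)] at hMN
  obtain ⟨e, he⟩ : ∃ e, e = ⌈q * N⌉₊ + 1 := ⟨_, rfl⟩
  have he1 : q * N + 1 ≤ e := by rw [he]; push_cast; linarith [Nat.le_ceil (q * N)]
  have he2 : (e : ℝ) < (posRatOf n.unpair.2 : ℝ) * N := by
    rw [he]; push_cast; linarith [Nat.ceil_lt_add_one (show 0 ≤ q * N by positivity)]
  have he3 : q + 1 / N ≤ e / N := by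
    rw [le_div_iff₀ hN, add_mul, one_div, inv_mul_cancel₀ hN.ne']; exact he1
  refine ⟨Nat.pair M e, ?_, fun A hA => ?_⟩
  · rw [posRatOf] at he2
    push_cast at he2
    rw [div_mul_eq_mul_div, lt_div_iff₀ (by positivity)] at he2
    simp only [Nat.unpair_pair, ← hNM]
    exact_mod_cast he2
  · simp only [Nat.unpair_pair, ← hNM]
    rw [length_filter_range]
    set K := (Finset.range N).filter fun k => ∃ i ∈ A, CellIn i N e k with hK
    let B : Set unitInterval := unitIdeal '' {i | i ∈ A}
    have hB : MeasurableSet B := ((List.finite_toSet A).image _).measurableSet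
    have h1 := left_measure_le_of_levyProkhorovEDist_lt hE hB
    rw [ENNReal.toReal_ofReal hq0.le, listMeasure_apply unitIdeal hL0 hB] at h1
    have hlen : A.length ≤ (L.filter fun i => decide (unitIdeal i ∈ B)).length := by
      have hs := (List.mem_sublists'.1 hA).filter fun i => decide (unitIdeal i ∈ B)
      rw [List.filter_eq_self.2 fun i hi => decide_eq_true ⟨i, hi, rfl⟩] at hs
      exact hs.length_le
    have hvol : volume (Metric.thickening q B) ≤ ENNReal.ofReal (K.card / N) := by
      calc volume (Metric.thickening q B)
          ≤ volume (⋃ k ∈ K, {x : unitInterval | (k : ℝ) / N ≤ x ∧ (x : ℝ) ≤ ((k : ℝ) + 1) / N}) := by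
            refine measure_mono fun x hx => ?_
            obtain ⟨_, ⟨i, hi, rfl⟩, hd⟩ := Metric.mem_thickening_iff.1 hx
            rw [Subtype.dist_eq, Real.dist_eq, abs_lt] at hd
            have hx0 : (0 : ℝ) ≤ x := x.2.1
            have hx1 : (x : ℝ) ≤ 1 := x.2.2
            obtain ⟨k, hkN, hk1, hk2⟩ : ∃ k < N, (k : ℝ) / N ≤ x ∧ (x : ℝ) ≤ ((k : ℝ) + 1) / N := by
              simp only [div_le_iff₀ hN, le_div_iff₀ hN]
              rcases hx1.lt_or_eq with hlt | heq
              · refine ⟨⌊(x : ℝ) * N⌋₊, ?_, Nat.floor_le (by positivity),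
                  (Nat.lt_floor_add_one _).le⟩
                rw [Nat.floor_lt (by positivity)]
                nlinarith
              · refine ⟨M, by omega, ?_, ?_⟩ <;> rw [heq, hNM] <;> push_cast <;> linarith
            refine Set.mem_iUnion₂.2 ⟨k, Finset.mem_filter.2 ⟨Finset.mem_range.2 hkN, i, hi,
              (cellIn_iff hN0).2 ?_⟩, hk1, hk2⟩
            rw [add_div] at hk2 ⊢
            constructor <;> linarith
        _ ≤ ∑ k ∈ K, volume {x : unitInterval | (k : ℝ) / N ≤ x ∧ (x : ℝ) ≤ ((k : ℝ) + 1) / N} :=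
            measure_biUnion_finset_le _ _
        _ = _ := by
            rw [Finset.sum_congr rfl fun k hk => volume_cell_Icc
              (Finset.mem_range.1 (Finset.mem_filter.1 hk).1), Finset.sum_const, nsmul_eq_mul,
              div_eq_mul_one_div (K.card : ℝ), ENNReal.ofReal_mul (by positivity), ENNReal.ofReal_natCast]
    have h2 := h1.trans (add_le_add hvol le_rfl)
    rw [← ENNReal.ofReal_add (by positivity) hq0.le,
      ENNReal.ofReal_le_ofReal_iff (by positivity)] at h2
    have h3 : (A.length : ℝ) / L.length ≤ (K.card + e) / N := by
      have h4 : (A.length : ℝ) / L.length ≤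
          (L.filter fun i => decide (unitIdeal i ∈ B)).length / L.length := by gcongr
      have h5 : (0 : ℝ) < 1 / N := by positivity
      rw [add_div]
      linarith
    rw [div_le_div_iff₀ hℓ hN] at h3
    exact_mod_cast h3

theorem isComputableMeasure_unitMeasure : IsComputableMeasure unitIdeal unitMeasure := by
  refine (rePred_exists primrec_cert).of_eq fun n => ?_
  have : unitMeasure.toMeasure = volume := rfl
  rw [idealBall, Metric.mem_ball, dist_comm, LevyProkhorov.dist_probabilityMeasure_def]
  exact ⟨fun ⟨_, h⟩ => cert_sound h, cert_complete⟩

theorem denseRange_unitIdeal : DenseRange unitIdeal := by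
  refine Metric.denseRange_iff.2 fun x r hr => ?_
  obtain ⟨M, hM⟩ := exists_nat_gt (1 / r)
  have hM' : (0 : ℝ) < (M : ℝ) + 1 := by positivity
  have hr' : 1 / ((M : ℝ) + 1) < r := by
    rw [div_lt_iff₀ hr] at hM
    rw [div_lt_iff₀ hM']
    nlinarith
  have hx0 : (0 : ℝ) ≤ x := x.2.1
  have hx1 : (x : ℝ) ≤ 1 := x.2.2
  refine ⟨Nat.pair ⌊(x : ℝ) * (M + 1)⌋₊ M, ?_⟩
  have h1 : (⌊(x : ℝ) * (M + 1)⌋₊ : ℝ) / (M + 1) ≤ x := by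
    rw [div_le_iff₀ hM']; exact Nat.floor_le (by positivity)
  have h2 : (x : ℝ) < (⌊(x : ℝ) * (M + 1)⌋₊ : ℝ) / (M + 1) + 1 / (M + 1) := by
    rw [← add_div, lt_div_iff₀ hM']; exact Nat.lt_floor_add_one _
  rw [Subtype.dist_eq, Real.dist_eq]
  simp only [unitIdeal, Nat.unpair_pair]
  rw [min_eq_left (h1.trans hx1), abs_lt]
  constructor <;> linarith

theorem dist_computable_unitIdeal :
    UniformlyComputableReal fun i j => dist (unitIdeal i) (unitIdeal j) := by
  let P : (ℕ × ℕ) × ℕ → ℕ := fun x => unitNum x.1.1 * (x.1.2.unpair.2 + 1)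
  let Q : (ℕ × ℕ) × ℕ → ℕ := fun x => unitNum x.1.2 * (x.1.1.unpair.2 + 1)
  let R : (ℕ × ℕ) × ℕ → ℕ := fun x => (x.1.1.unpair.2 + 1) * (x.1.2.unpair.2 + 1) - 1
  have h1 : Primrec fun x : (ℕ × ℕ) × ℕ => x.1.1 := Primrec.fst.comp Primrec.fst
  have h2 : Primrec fun x : (ℕ × ℕ) × ℕ => x.1.2 := Primrec.snd.comp Primrec.fst
  have d1 := Primrec.succ.comp (Primrec.snd.comp (Primrec.unpair.comp h1))
  have d2 := Primrec.succ.comp (Primrec.snd.comp (Primrec.unpair.comp h2))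
  have hP : Primrec P := Primrec.nat_mul.comp (primrec_unitNum.comp h1) d2
  have hQ : Primrec Q := Primrec.nat_mul.comp (primrec_unitNum.comp h2) d1
  have hR : Primrec R := Primrec.pred.comp (Primrec.nat_mul.comp d1 d2)
  refine ⟨fun x => Nat.pair (Nat.pair (max (P x) (Q x)) (min (P x) (Q x))) (R x),
    (Primrec₂.natPair.comp (Primrec₂.natPair.comp (Primrec.nat_max.comp hP hQ)
      (Primrec.nat_min.comp hP hQ)) hR).to_comp, fun i j n => ?_⟩
  have hi : (0 : ℝ) < (i.unpair.2 : ℝ) + 1 := by positivity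
  have hj : (0 : ℝ) < (j.unpair.2 : ℝ) + 1 := by positivity
  have e : (ratOf (Nat.pair (Nat.pair (max (P ((i, j), n)) (Q ((i, j), n)))
      (min (P ((i, j), n)) (Q ((i, j), n)))) (R ((i, j), n))) : ℝ) =
        dist (unitIdeal i) (unitIdeal j) := by
    have hR1 : ((R ((i, j), n) : ℕ) : ℝ) + 1 = ((i.unpair.2 : ℝ) + 1) * ((j.unpair.2 : ℝ) + 1) := by
      have : R ((i, j), n) + 1 = (i.unpair.2 + 1) * (j.unpair.2 + 1) :=
        Nat.sub_add_cancel (Nat.mul_pos (Nat.succ_pos _) (Nat.succ_pos _))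
      exact_mod_cast this
    rw [Subtype.dist_eq, Real.dist_eq, coe_unitIdeal, coe_unitIdeal, div_sub_div _ _ hi.ne' hj.ne',
      abs_div, abs_of_pos (mul_pos hi hj), ratOf]
    simp only [Nat.unpair_pair]
    push_cast
    rw [hR1, max_sub_min_eq_abs']
    simp only [P, Q]
    push_cast
    rw [mul_comm ((i.unpair.2 : ℝ) + 1) (unitNum j : ℝ)]
  rw [e, sub_self, abs_zero]
  positivity

/-- `[0, 1]` with Lebesgue measure is a computable probability space. -/
theorem unitInterval_isComputableProbabilitySpace :
    IsComputableProbabilitySpace unitIdeal unitMeasure :=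
  ⟨⟨inferInstance, denseRange_unitIdeal, dist_computable_unitIdeal⟩,
    isComputableMeasure_unitMeasure⟩

end CompProb

/-! Points of `X` are coded by binary sequences, and a sequence is sent to a real number by the
lexicographic distribution function of `μ`.

The code has to be readable effectively up to a null set. A ball serves for this if its sphere is
null, and all but countably many radii have this property. Such balls can be found effectively
because the measure of an r.e. open set is lower semicomputable (`lowerSemicomputable_measureReal`).
The result is `exists_almostDecidable`: disjoint pairs of r.e. open sets of total measure one, whose
first members cover `X` at every scale `1 / (j + 1)`.

A word `w` has a cylinder and an interval from `lo w` to `hi w` whose length is the measure of the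
cylinder. The intervals of the words of a fixed length tile `[0, 1]` in lexicographic order. The
numbers `lo w`, `1 - hi w` and the length are measures of r.e. open sets, hence approximable from
below; as they add up to one, the end points are computable. Since small sets occur at every scale,
the cylinders along a sequence have at most one common point. Without atoms this intersection is
null, so the lengths tend to zero (`tendsto_measureReal_cyl`). Therefore `toUnit`, which sends a
point to the common point of the intervals of its itinerary, is computable, and comparison with the
end points shows that its distribution function is the identity (`map_toUnit`).

Conversely, a real number in the interior of its intervals has only one itinerary. If the letter
`true` occurs in it at every scale, the cylinders contain a Cauchy sequence, and completeness yields
`ofUnit`. The limit may leave the open cylinders, so closures are used. The two maps are inverse to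
each other where both make sense, and measure preservation of `ofUnit` is inherited from `toUnit`
(`map_ofUnit`). -/

/-! ### Recursively enumerable predicates -/

namespace REPred

variable {α β : Type*} [Primcodable α] [Primcodable β]

theorem comp {p : β → Prop} {f : α → β} (hp : REPred p) (hf : Computable f) :
    REPred fun a => p (f a) :=
  Partrec.comp hp hf

/-- Every r.e. predicate is the union of an increasing sequence of uniformly primitive recursive
predicates. -/
theorem exists_primrecRel {p : α → Prop} (hp : REPred p) :
    ∃ R : α → ℕ → Prop, PrimrecRel R ∧ (∀ a m n, m ≤ n → R a m → R a n) ∧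
      ∀ a, p a ↔ ∃ n, R a n := by
  obtain ⟨c, hc⟩ := Nat.Partrec.Code.exists_code.1 hp
  -- The stage `n` bounds the simulation of a program. Monotonicity in `n` allows finitely many
  -- stages to be replaced by their maximum.
  refine ⟨fun a n => (Nat.Partrec.Code.evaln n c (Encodable.encode a)).isSome = true, ?_, ?_, ?_⟩
  · have h : Primrec fun x : α × ℕ => Nat.Partrec.Code.evaln x.2 c (Encodable.encode x.1) :=
      Nat.Partrec.Code.primrec_evaln.comp (Primrec.pair (Primrec.pair Primrec.snd
        (Primrec.const c)) (Primrec.encode.comp Primrec.fst))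
    exact Primrec.eq.comp (Primrec.option_isSome.comp h) (Primrec.const true)
  · intro a m n hmn h
    obtain ⟨x, hx⟩ := Option.isSome_iff_exists.1 h
    exact Option.isSome_iff_exists.2 ⟨x, Nat.Partrec.Code.evaln_mono hmn hx⟩
  · intro a
    have h1 : p a ↔ (Nat.Partrec.Code.eval c (Encodable.encode a)).Dom := by
      rw [hc]; simp [Part.assert]
    rw [h1, Part.dom_iff_mem]
    simp only [Nat.Partrec.Code.evaln_complete, Option.isSome_iff_exists, Option.mem_def]
    exact exists_comm

theorem of_primrecPred {p : α → Prop} (hp : PrimrecPred p) : REPred p :=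
  hp.computablePred.to_re

theorem and {p q : α → Prop} (hp : REPred p) (hq : REPred q) : REPred fun a => p a ∧ q a := by
  obtain ⟨R, hR, hm, h⟩ := hp.exists_primrecRel
  obtain ⟨S, hS, hm', h'⟩ := hq.exists_primrecRel
  refine (CompProb.rePred_exists (R := fun a n => R a n ∧ S a n) (hR.and hS)).of_eq fun a => ?_
  rw [h, h']
  exact ⟨fun ⟨n, h1, h2⟩ => ⟨⟨n, h1⟩, n, h2⟩, fun ⟨⟨m, h1⟩, n, h2⟩ =>
    ⟨max m n, hm _ _ _ (le_max_left _ _) h1, hm' _ _ _ (le_max_right _ _) h2⟩⟩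

theorem or {p q : α → Prop} (hp : REPred p) (hq : REPred q) : REPred fun a => p a ∨ q a := by
  obtain ⟨R, hR, hm, h⟩ := hp.exists_primrecRel
  obtain ⟨S, hS, hm', h'⟩ := hq.exists_primrecRel
  refine (CompProb.rePred_exists (R := fun a n => R a n ∨ S a n) (hR.or hS)).of_eq fun a => ?_
  rw [h, h', exists_or]

/-- Dovetailing: one number codes both the witness and the stage at which it is confirmed. -/
theorem exists_snd {p : α × β → Prop} (hp : REPred p) : REPred fun a => ∃ b, p (a, b) := by
  classical
  obtain ⟨R, hR, hm, h⟩ := hp.exists_primrecRel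
  have hg : Primrec₂ fun (x : α × ℕ) (b : β) => decide (R (x.1, b) x.2.unpair.2) := by
    exact (hR.comp (Primrec.pair (Primrec.fst.comp Primrec.fst) Primrec.snd)
      (Primrec.snd.comp (Primrec.unpair.comp (Primrec.snd.comp Primrec.fst)))).decide
  have hd : Primrec fun x : α × ℕ => (Encodable.decode x.2.unpair.1 : Option β) :=
    Primrec.decode.comp (Primrec.fst.comp (Primrec.unpair.comp Primrec.snd))
  have := Primrec.option_casesOn hd (Primrec.const false) hg
  refine (CompProb.rePred_exists (R := fun a n => (Option.casesOn
    (Encodable.decode n.unpair.1 : Option β) false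
      (fun b => decide (R (a, b) n.unpair.2)) : Bool) = true)
    (Primrec.eq.comp this (Primrec.const true))).of_eq fun a => ?_
  constructor
  · rintro ⟨n, hn⟩
    cases hd : (Encodable.decode n.unpair.1 : Option β) with
    | none => simp [hd] at hn
    | some b => exact ⟨b, (h _).2 ⟨_, by simpa [hd] using hn⟩⟩
  · rintro ⟨b, hb⟩
    obtain ⟨n, hn⟩ := (h _).1 hb
    exact ⟨Nat.pair (Encodable.encode b) n, by simpa using hn⟩

theorem forall_mem_list {p : β × α → Prop} (hp : REPred p) :
    REPred fun x : List β × α => ∀ b ∈ x.1, p (b, x.2) := by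
  obtain ⟨R, hR, hm, h⟩ := hp.exists_primrecRel
  have h1 : PrimrecRel fun (b : β) (y : α × ℕ) => R (b, y.1) y.2 :=
    hR.comp (Primrec.pair Primrec.fst (Primrec.fst.comp Primrec.snd))
      (Primrec.snd.comp Primrec.snd)
  have h2 : PrimrecRel fun (x : List β × α) (n : ℕ) => ∀ b ∈ x.1, R (b, x.2) n :=
    h1.forall_mem_list.comp (Primrec.fst.comp Primrec.fst)
      (Primrec.pair (Primrec.snd.comp Primrec.fst) Primrec.snd)
  refine (CompProb.rePred_exists h2).of_eq fun ⟨l, a⟩ => ?_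
  simp only [h]
  constructor
  · rintro ⟨n, hn⟩ b hb
    exact ⟨n, hn b hb⟩
  · intro hl
    induction l with
    | nil => exact ⟨0, by simp⟩
    | cons b l ih =>
      obtain ⟨n, hn⟩ := ih fun b hb => hl b (List.mem_cons_of_mem _ hb)
      obtain ⟨m, hm'⟩ := hl b List.mem_cons_self
      refine ⟨max m n, fun c hc => ?_⟩
      rcases List.mem_cons.1 hc with rfl | hc
      · exact hm _ _ _ (le_max_left _ _) hm'
      · exact hm _ _ _ (le_max_right _ _) (hn c hc)

theorem forall_lt {p : α × ℕ → Prop} (hp : REPred p) {ℓ : α → ℕ} (hℓ : Computable ℓ) :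
    REPred fun a => ∀ m < ℓ a, p (a, m) := by
  have h := (hp.comp (Computable.pair Computable.snd Computable.fst :
    Computable fun x : ℕ × α => (x.2, x.1))).forall_mem_list
  refine (h.comp (Computable.pair (Primrec.list_range.to_comp.comp hℓ) Computable.id)).of_eq
    fun a => ?_
  simp

/-- Uniformization: the search runs over pairs of a value and a stage, because the predicate at a
single value need not be decidable. -/
theorem exists_computable {p : α × ℕ → Prop} (hp : REPred p) (h : ∀ a, ∃ n, p (a, n)) :
    ∃ f : α → ℕ, Computable f ∧ ∀ a, p (a, f a) := by
  classical
  obtain ⟨R, hR, hm, hRp⟩ := hp.exists_primrecRel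
  have hP : PrimrecPred fun x : α × ℕ => R (x.1, x.2.unpair.1) x.2.unpair.2 := by
    have hu : Primrec fun x : α × ℕ => x.2.unpair := Primrec.unpair.comp Primrec.snd
    exact hR.comp (Primrec.pair Primrec.fst (Primrec.fst.comp hu)) (Primrec.snd.comp hu)
  have hex : ∀ a, ∃ k : ℕ, R (a, k.unpair.1) k.unpair.2 := fun a => by
    obtain ⟨n, hn⟩ := h a
    obtain ⟨m, hm⟩ := (hRp _).1 hn
    exact ⟨Nat.pair n m, by simpa using hm⟩
  exact ⟨fun a => (Nat.find (hex a)).unpair.1,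
    Computable.fst.comp (Computable.unpair.comp
      (Computable.find (P := fun a k => R (a, k.unpair.1) k.unpair.2) hP.computablePred hex)),
    fun a => (hRp _).2 ⟨_, Nat.find_spec (hex a)⟩⟩

end REPred

namespace CompProb

variable {α β : Type*} [Primcodable α] [Primcodable β]

/-! ### Lower semicomputable real functions -/

/-- After clearing denominators, negative terms move to the other side, so that only sums and
products of natural numbers are compared. -/
theorem primrecPred_ratOf_lt : PrimrecPred fun x : ℕ × ℕ => ratOf x.1 < ratOf x.2 := by
  have h1 : Primrec fun x : ℕ × ℕ => x.1.unpair := Primrec.unpair.comp Primrec.fst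
  have h2 : Primrec fun x : ℕ × ℕ => x.2.unpair := Primrec.unpair.comp Primrec.snd
  have u1 := Primrec.unpair.comp (Primrec.fst.comp h1)
  have u2 := Primrec.unpair.comp (Primrec.fst.comp h2)
  have d1 := Primrec.succ.comp (Primrec.snd.comp h1)
  have d2 := Primrec.succ.comp (Primrec.snd.comp h2)
  have := Primrec.nat_lt.comp
    (Primrec.nat_add.comp (Primrec.nat_mul.comp (Primrec.fst.comp u1) d2)
      (Primrec.nat_mul.comp (Primrec.snd.comp u2) d1))
    (Primrec.nat_add.comp (Primrec.nat_mul.comp (Primrec.fst.comp u2) d1)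
      (Primrec.nat_mul.comp (Primrec.snd.comp u1) d2))
  refine this.of_eq fun x => ?_
  rw [ratOf, ratOf, div_lt_div_iff₀ (by positivity) (by positivity), ← @Nat.cast_lt ℚ]
  push_cast
  rw [← sub_pos, ← sub_pos (b := (_ : ℚ) * _)]
  ring_nf

theorem primrecPred_ratOf_le_add :
    PrimrecPred fun x : ℕ × ℕ × ℕ => ratOf x.1 ≤ ratOf x.2.1 + ratOf x.2.2 := by
  have h1 : Primrec fun x : ℕ × ℕ × ℕ => x.1.unpair := Primrec.unpair.comp Primrec.fst
  have h2 : Primrec fun x : ℕ × ℕ × ℕ => x.2.1.unpair :=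
    Primrec.unpair.comp (Primrec.fst.comp Primrec.snd)
  have h3 : Primrec fun x : ℕ × ℕ × ℕ => x.2.2.unpair :=
    Primrec.unpair.comp (Primrec.snd.comp Primrec.snd)
  have u1 := Primrec.unpair.comp (Primrec.fst.comp h1)
  have u2 := Primrec.unpair.comp (Primrec.fst.comp h2)
  have u3 := Primrec.unpair.comp (Primrec.fst.comp h3)
  have d1 := Primrec.succ.comp (Primrec.snd.comp h1)
  have d2 := Primrec.succ.comp (Primrec.snd.comp h2)
  have d3 := Primrec.succ.comp (Primrec.snd.comp h3)
  have e1 := Primrec.nat_mul.comp d2 d3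
  have e2 := Primrec.nat_mul.comp d1 d3
  have e3 := Primrec.nat_mul.comp d1 d2
  have := Primrec.nat_le.comp
    (Primrec.nat_add.comp (Primrec.nat_mul.comp (Primrec.fst.comp u1) e1)
      (Primrec.nat_add.comp (Primrec.nat_mul.comp (Primrec.snd.comp u2) e2)
        (Primrec.nat_mul.comp (Primrec.snd.comp u3) e3)))
    (Primrec.nat_add.comp (Primrec.nat_mul.comp (Primrec.snd.comp u1) e1)
      (Primrec.nat_add.comp (Primrec.nat_mul.comp (Primrec.fst.comp u2) e2)
        (Primrec.nat_mul.comp (Primrec.fst.comp u3) e3)))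
  refine this.of_eq fun x => ?_
  rw [ratOf, ratOf, ratOf, div_add_div _ _ (by positivity) (by positivity),
    div_le_div_iff₀ (by positivity) (by positivity), ← @Nat.cast_le ℚ]
  push_cast
  rw [← sub_nonneg, ← sub_nonneg (b := (_ : ℚ) * _)]
  ring_nf

theorem ratOf_surjective : Function.Surjective ratOf := by
  intro q
  refine ⟨Nat.pair (Nat.pair q.num.toNat (-q.num).toNat) (q.den - 1), ?_⟩
  have h1 : ((q.num.toNat : ℕ) : ℚ) - ((-q.num).toNat : ℕ) = q.num := by
    exact_mod_cast Int.toNat_sub_toNat_neg q.num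
  have h2 : (((q.den - 1 : ℕ) : ℚ)) + 1 = q.den := by
    exact_mod_cast Nat.sub_add_cancel q.den_pos
  simp only [ratOf, Nat.unpair_pair, h1, h2, Rat.num_div_den]

theorem exists_ratOf_btwn {a b : ℝ} (h : a < b) : ∃ n, a < ratOf n ∧ (ratOf n : ℝ) < b := by
  obtain ⟨q, h1, h2⟩ := exists_rat_btwn h
  obtain ⟨n, rfl⟩ := ratOf_surjective q
  exact ⟨n, h1, h2⟩

/-- The real function `f` is lower semicomputable: the rationals below `f a` are r.e., uniformly
in `a`. -/
def LowerSemicomputable (f : α → ℝ) : Prop :=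
  REPred fun x : α × ℕ => (ratOf x.2 : ℝ) < f x.1

namespace LowerSemicomputable

theorem of_eq {f g : α → ℝ} (hf : LowerSemicomputable f) (h : ∀ a, f a = g a) :
    LowerSemicomputable g :=
  (funext h : f = g) ▸ hf

theorem comp {f : β → ℝ} (hf : LowerSemicomputable f) {g : α → β} (hg : Computable g) :
    LowerSemicomputable fun a => f (g a) :=
  REPred.comp (f := fun x : α × ℕ => (g x.1, x.2)) hf
    (Computable.pair (hg.comp Computable.fst) Computable.snd)

theorem pos {f : α → ℝ} (hf : LowerSemicomputable f) : REPred fun a => 0 < f a := by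
  refine (REPred.comp (f := fun a : α => (a, 0)) hf
    (Computable.pair Computable.id (Computable.const 0))).of_eq fun a => ?_
  have : ratOf 0 = 0 := by simp [ratOf]
  simp [this]

theorem ratOf {φ : α → ℕ} (hφ : Computable φ) :
    LowerSemicomputable fun a => (CompProb.ratOf (φ a) : ℝ) := by
  refine ((REPred.of_primrecPred primrecPred_ratOf_lt).comp
    (f := fun x : α × ℕ => (x.2, φ x.1)) (Computable.pair Computable.snd
      (hφ.comp Computable.fst))).of_eq fun x => ?_
  simp

theorem natCast_sub_div {A B C : α → ℕ} (hA : Computable A) (hB : Computable B)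
    (hC : Computable C) : LowerSemicomputable fun a => ((A a : ℝ) - B a) / (C a + 1) := by
  refine (ratOf (φ := fun a => Nat.pair (Nat.pair (A a) (B a)) (C a))
    (Primrec₂.natPair.to_comp.comp (Primrec₂.natPair.to_comp.comp hA hB) hC)).of_eq fun a => ?_
  simp [CompProb.ratOf]

theorem neg_ratOf : LowerSemicomputable fun n : ℕ => -(CompProb.ratOf n : ℝ) := by
  have hu := Computable.unpair
  have hv := Computable.unpair.comp (Computable.fst.comp hu)
  refine (natCast_sub_div (Computable.snd.comp hv) (Computable.fst.comp hv)
    (Computable.snd.comp hu)).of_eq fun x => ?_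
  rw [CompProb.ratOf]
  push_cast
  rw [← neg_div, neg_sub]

theorem natCast_div {A C : α → ℕ} (hA : Computable A) (hC : Computable C) :
    LowerSemicomputable fun a => (A a : ℝ) / (C a + 1) :=
  (natCast_sub_div hA (Computable.const 0) hC).of_eq fun a => by simp

theorem neg_natCast_div {B C : α → ℕ} (hB : Computable B) (hC : Computable C) :
    LowerSemicomputable fun a => -((B a : ℝ) / (C a + 1)) :=
  (natCast_sub_div (Computable.const 0) hB hC).of_eq fun a => by simp [neg_div]

theorem const_neg_nat (k : ℕ) : LowerSemicomputable fun _ : α => -(k : ℝ) :=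
  (neg_natCast_div (Computable.const k) (Computable.const 0)).of_eq fun a => by simp

/-- A rational is below a sum iff it is at most a sum of rationals below the two terms. For the
converse, once the first rational is chosen between `q - g a` and `f a`, the second is the exact
difference. -/
theorem add {f g : α → ℝ} (hf : LowerSemicomputable f) (hg : LowerSemicomputable g) :
    LowerSemicomputable fun a => f a + g a := by
  have c1 : Computable fun y : (α × ℕ) × ℕ × ℕ => (y.1.1, y.2.1) :=
    Computable.pair (Computable.fst.comp Computable.fst) (Computable.fst.comp Computable.snd)
  have c2 : Computable fun y : (α × ℕ) × ℕ × ℕ => (y.1.1, y.2.2) :=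
    Computable.pair (Computable.fst.comp Computable.fst) (Computable.snd.comp Computable.snd)
  have c3 : Computable fun y : (α × ℕ) × ℕ × ℕ => (y.1.2, y.2) :=
    Computable.pair (Computable.snd.comp Computable.fst) Computable.snd
  refine (((REPred.comp hf c1).and (REPred.comp hg c2)).and
    ((REPred.of_primrecPred primrecPred_ratOf_le_add).comp c3)).exists_snd.of_eq fun ⟨a, q⟩ => ?_
  simp only [Prod.exists]
  constructor
  · rintro ⟨m, k, ⟨h1, h2⟩, h3⟩
    have : (CompProb.ratOf q : ℝ) ≤ CompProb.ratOf m + CompProb.ratOf k := by exact_mod_cast h3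
    linarith
  · intro h
    obtain ⟨m, hm1, hm2⟩ := exists_ratOf_btwn (show CompProb.ratOf q - g a < f a by linarith)
    obtain ⟨k, hk⟩ := ratOf_surjective (CompProb.ratOf q - CompProb.ratOf m)
    refine ⟨m, k, ⟨hm2, ?_⟩, by rw [hk]; linarith⟩
    rw [hk]
    push_cast
    linarith

theorem lt {f g : α → ℝ} (hf : LowerSemicomputable fun a => -f a) (hg : LowerSemicomputable g) :
    REPred fun a => f a < g a :=
  (hf.add hg).pos.of_eq fun a => by rw [neg_add_eq_sub, sub_pos]

/-- This is closure under suprema of uniformly lower semicomputable families, expressed without `⨆`.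
-/
theorem of_forall_lt_iff {f : α → ℝ} {g : α × β → ℝ} (hg : LowerSemicomputable g)
    (h : ∀ a q, q < f a ↔ ∃ b, q < g (a, b)) : LowerSemicomputable f := by
  have c : Computable fun y : (α × ℕ) × β => ((y.1.1, y.2), y.1.2) :=
    Computable.pair (Computable.pair (Computable.fst.comp Computable.fst) Computable.snd)
      (Computable.snd.comp Computable.fst)
  exact (REPred.comp hg c).exists_snd.of_eq fun ⟨a, q⟩ => (h a (CompProb.ratOf q)).symm

end LowerSemicomputable

/-! ### Families of r.e. open sets -/

/-- The sets `U a` are r.e. open, uniformly in `a`. -/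
def REOpen {X : Type*} [PseudoMetricSpace X] (s : ℕ → X) (U : α → Set X) : Prop :=
  ∃ E : α → Set ℕ, (REPred fun p : α × ℕ => p.2 ∈ E p.1) ∧
    ∀ a, U a = ⋃ n ∈ E a, idealBall s n

namespace REOpen

variable {X : Type*} [PseudoMetricSpace X] {s : ℕ → X}

theorem of_rel {U : α → Set X} {R : α × ℕ → Prop} (hR : REPred R)
    (h : ∀ a x, x ∈ U a ↔ ∃ n, R (a, n) ∧ x ∈ idealBall s n) : REOpen s U := by
  refine ⟨fun a => {n | R (a, n)}, hR, fun a => ?_⟩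
  ext x
  simp [h]

theorem exists_rel {U : α → Set X} (h : REOpen s U) : ∃ R : α × ℕ → Prop,
    REPred R ∧ ∀ a x, x ∈ U a ↔ ∃ n, R (a, n) ∧ x ∈ idealBall s n := by
  obtain ⟨E, hE, h⟩ := h
  refine ⟨fun p => p.2 ∈ E p.1, hE, fun a x => ?_⟩
  simp [h]

theorem of_eq {U V : α → Set X} (hU : REOpen s U) (h : ∀ a, U a = V a) : REOpen s V :=
  (funext h : U = V) ▸ hU

theorem isOpen {U : α → Set X} (hU : REOpen s U) (a : α) : IsOpen (U a) := by
  obtain ⟨E, -, h⟩ := hU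
  rw [h]
  exact isOpen_biUnion fun _ _ => Metric.isOpen_ball

theorem comp {U : β → Set X} (hU : REOpen s U) {f : α → β} (hf : Computable f) :
    REOpen s fun a => U (f a) := by
  obtain ⟨E, hE, h⟩ := hU
  exact ⟨fun a => E (f a), hE.comp (f := fun p : α × ℕ => (f p.1, p.2))
    (Computable.pair (hf.comp Computable.fst) Computable.snd), fun a => h _⟩

/-- R.e. unions of r.e. open sets are r.e. open. -/
theorem exists_and {U : α × β → Set X} (hU : REOpen s U) {p : α × β → Prop} (hp : REPred p) :
    REOpen s fun a => {x | ∃ b, p (a, b) ∧ x ∈ U (a, b)} := by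
  obtain ⟨R, hR, h⟩ := hU.exists_rel
  have c1 : Computable fun y : (α × ℕ) × β => (y.1.1, y.2) :=
    Computable.pair (Computable.fst.comp Computable.fst) Computable.snd
  have c2 : Computable fun y : (α × ℕ) × β => ((y.1.1, y.2), y.1.2) :=
    Computable.pair c1 (Computable.snd.comp Computable.fst)
  refine of_rel
    ((hp.comp c1).and (hR.comp c2)).exists_snd fun a x => ?_
  simp only [h, Set.mem_ofPred_eq]
  exact ⟨fun ⟨b, h1, n, h2, h3⟩ => ⟨n, ⟨b, h1, h2⟩, h3⟩,
    fun ⟨n, ⟨b, h1, h2⟩, h3⟩ => ⟨b, h1, n, h2, h3⟩⟩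

theorem exists_snd {U : α × β → Set X} (hU : REOpen s U) :
    REOpen s fun a => {x | ∃ b, x ∈ U (a, b)} :=
  (hU.exists_and (p := fun _ => True) (REPred.of_primrecPred
    (Primrec.eq.comp (Primrec.const 0) (Primrec.const 0) :
      PrimrecPred fun _ : α × β => (0 : ℕ) = 0) |>.of_eq fun _ => by simp)).of_eq
    fun a => by simp

theorem union {U V : α → Set X} (hU : REOpen s U) (hV : REOpen s V) :
    REOpen s fun a => U a ∪ V a := by
  obtain ⟨R, hR, h⟩ := hU.exists_rel
  obtain ⟨R', hR', h'⟩ := hV.exists_rel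
  refine of_rel (hR.or hR') fun a x => ?_
  simp only [Set.mem_union, h, h', or_and_right, exists_or]

end REOpen

/-! ### Positive rationals and small ideal balls. -/

theorem LowerSemicomputable.posRatOf :
    LowerSemicomputable fun n : ℕ => (CompProb.posRatOf n : ℝ) :=
  (natCast_div (Computable.succ.comp (Computable.fst.comp Computable.unpair))
    (Computable.snd.comp Computable.unpair)).of_eq fun n => by simp [CompProb.posRatOf]

theorem LowerSemicomputable.neg_posRatOf :
    LowerSemicomputable fun n : ℕ => -(CompProb.posRatOf n : ℝ) :=
  (neg_natCast_div (Computable.succ.comp (Computable.fst.comp Computable.unpair))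
    (Computable.snd.comp Computable.unpair)).of_eq fun n => by simp [CompProb.posRatOf]

theorem posRatOf_pos (n : ℕ) : (0 : ℝ) < posRatOf n := by
  rw [posRatOf]; push_cast; positivity

theorem posRatOf_pair (a b : ℕ) : (posRatOf (Nat.pair a b) : ℝ) = ((a : ℝ) + 1) / ((b : ℝ) + 1) := by
  simp [posRatOf]

theorem exists_posRatOf_eq {q : ℚ} (hq : 0 < q) : ∃ n, posRatOf n = q := by
  refine ⟨Nat.pair (q.num.toNat - 1) (q.den - 1), ?_⟩
  have h0 : 0 < q.num := Rat.num_pos.2 hq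
  have h1 : ((q.num.toNat - 1 : ℕ) : ℚ) + 1 = q.num := by
    have : (q.num.toNat - 1) + 1 = q.num.toNat := Nat.sub_add_cancel (by omega)
    have h2 : ((q.num.toNat : ℕ) : ℤ) = q.num := Int.toNat_of_nonneg h0.le
    exact_mod_cast (congrArg (Nat.cast : ℕ → ℤ) this).trans h2
  have h2 : (((q.den - 1 : ℕ) : ℚ)) + 1 = q.den := by
    exact_mod_cast Nat.sub_add_cancel q.den_pos
  simp only [posRatOf, Nat.unpair_pair, h1, h2, Rat.num_div_den]

theorem exists_posRatOf_btwn {a b : ℝ} (ha : 0 ≤ a) (h : a < b) :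
    ∃ n, a < posRatOf n ∧ (posRatOf n : ℝ) < b := by
  obtain ⟨q, h1, h2⟩ := exists_rat_btwn h
  obtain ⟨n, rfl⟩ := exists_posRatOf_eq (q := q) (by exact_mod_cast ha.trans_lt h1)
  exact ⟨n, h1, h2⟩

theorem exists_mem_idealBall {X : Type*} [PseudoMetricSpace X] {s : ℕ → X} (hs : DenseRange s)
    (x : X) {ε : ℝ} (hε : 0 < ε) : ∃ n, x ∈ idealBall s n ∧ (posRatOf n.unpair.2 : ℝ) < ε := by
  obtain ⟨m, h1, h2⟩ := exists_posRatOf_btwn le_rfl hε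
  obtain ⟨i, hi⟩ := Metric.denseRange_iff.1 hs x _ h1
  exact ⟨Nat.pair i m, by simpa [idealBall] using hi, by simpa using h2⟩

/-! ### Effective topology of a computable metric space. -/

section metric

variable {X : Type*} [MetricSpace X] {s : ℕ → X}

/-- The distance is the supremum of its rational approximations, each diminished by a bound on its
error. -/
theorem IsComputableMetricSpace.lowerSemicomputable_dist (hs : IsComputableMetricSpace s) :
    LowerSemicomputable fun p : ℕ × ℕ => dist (s p.1) (s p.2) := by
  obtain ⟨φ, hφ, h⟩ := hs.dist_computable
  refine ((LowerSemicomputable.ratOf hφ).add (LowerSemicomputable.neg_natCast_div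
    (Computable.const 1) Computable.snd)).of_forall_lt_iff fun p q => ?_
  -- The error bound is relaxed to `1 / (n + 1)`, for which semicomputability has been proved.
  have h2 : ∀ n : ℕ, (2 : ℝ)⁻¹ ^ n ≤ 1 / ((n : ℝ) + 1) := fun n => by
    rw [inv_pow, ← one_div]
    exact one_div_le_one_div_of_le (by positivity) (by exact_mod_cast Nat.lt_two_pow_self)
  simp only [Nat.cast_one, ← sub_eq_add_neg]
  constructor
  · intro hq
    obtain ⟨n, hn⟩ := exists_nat_one_div_lt (half_pos (sub_pos.2 hq))
    refine ⟨n, ?_⟩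
    have := abs_lt.1 (h p.1 p.2 n)
    linarith [h2 n]
  · rintro ⟨n, hn⟩
    have := abs_lt.1 (h p.1 p.2 n)
    linarith [h2 n]

theorem IsComputableMetricSpace.lowerSemicomputable_neg_dist (hs : IsComputableMetricSpace s) :
    LowerSemicomputable fun p : ℕ × ℕ => -dist (s p.1) (s p.2) := by
  obtain ⟨φ, hφ, h⟩ := hs.dist_computable
  refine ((LowerSemicomputable.neg_ratOf.comp hφ).add (LowerSemicomputable.neg_natCast_div
    (Computable.const 1) Computable.snd)).of_forall_lt_iff fun p q => ?_
  have h2 : ∀ n : ℕ, (2 : ℝ)⁻¹ ^ n ≤ 1 / ((n : ℝ) + 1) := fun n => by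
    rw [inv_pow, ← one_div]
    exact one_div_le_one_div_of_le (by positivity) (by exact_mod_cast Nat.lt_two_pow_self)
  simp only [Nat.cast_one, ← sub_eq_add_neg]
  constructor
  · intro hq
    obtain ⟨n, hn⟩ := exists_nat_one_div_lt (half_pos (sub_pos.2 hq))
    refine ⟨n, ?_⟩
    have := abs_lt.1 (h p.1 p.2 n)
    linarith [h2 n]
  · rintro ⟨n, hn⟩
    have := abs_lt.1 (h p.1 p.2 n)
    linarith [h2 n]

/-- The ball is the union of the ideal balls that are formally inside it: distance of the centers
plus the smaller radius is less than `r`. This strict inequality is r.e. even if `r` is only lower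
semicomputable, whereas true inclusion need not be. -/
theorem IsComputableMetricSpace.reOpen_ball (hs : IsComputableMetricSpace s)
    {i : α → ℕ} (hi : Computable i) {r : α → ℝ}
    (hr : LowerSemicomputable r) : REOpen s fun a => Metric.ball (s (i a)) (r a) := by
  have hu := Computable.unpair.comp (Computable.snd (α := α) (β := ℕ))
  have h1 := hs.lowerSemicomputable_neg_dist.comp
    (Computable.pair (Computable.fst.comp hu) (hi.comp Computable.fst))
  have h2 := LowerSemicomputable.neg_posRatOf.comp (Computable.snd.comp hu)
  refine REOpen.of_rel ((h1.add h2).add (hr.comp Computable.fst)).pos fun a x => ?_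
  simp only [idealBall, Metric.mem_ball]
  constructor
  · intro hx
    obtain ⟨n, hn, hn'⟩ := exists_mem_idealBall hs.dense x (half_pos (sub_pos.2 hx))
    refine ⟨n, ?_, hn⟩
    rw [idealBall, Metric.mem_ball] at hn
    linarith [dist_triangle_left (s n.unpair.1) (s (i a)) x]
  · rintro ⟨n, hn, hx⟩
    linarith [dist_triangle x (s n.unpair.1) (s (i a))]

/-- Formal disjointness of balls replaces formal inclusion: here the distance of the centers must
exceed the sum of the radii. -/
theorem IsComputableMetricSpace.reOpen_lt_dist (hs : IsComputableMetricSpace s)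
    {i : α → ℕ} (hi : Computable i) {r : α → ℝ}
    (hr : LowerSemicomputable fun a => -r a) :
    REOpen s fun a => {x | r a < dist x (s (i a))} := by
  have hu := Computable.unpair.comp (Computable.snd (α := α) (β := ℕ))
  have h1 := hs.lowerSemicomputable_dist.comp
    (Computable.pair (Computable.fst.comp hu) (hi.comp Computable.fst))
  have h2 := LowerSemicomputable.neg_posRatOf.comp (Computable.snd.comp hu)
  refine REOpen.of_rel ((h1.add h2).add (hr.comp Computable.fst)).pos fun a x => ?_
  simp only [idealBall, Metric.mem_ball, Set.mem_ofPred_eq]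
  constructor
  · intro hx
    obtain ⟨n, hn, hn'⟩ := exists_mem_idealBall hs.dense x (half_pos (sub_pos.2 hx))
    refine ⟨n, ?_, hn⟩
    rw [idealBall, Metric.mem_ball] at hn
    linarith [dist_triangle x (s n.unpair.1) (s (i a))]
  · rintro ⟨n, hn, hx⟩
    linarith [dist_triangle_left (s n.unpair.1) (s (i a)) x]

/-- Finite intersections of r.e. open sets are r.e. open, uniformly. -/
theorem IsComputableMetricSpace.reOpen_forall_lt (hs : IsComputableMetricSpace s)
    {U : α × ℕ → Set X} (hU : REOpen s U)
    {ℓ : α → ℕ} (hℓ : Computable ℓ) : REOpen s fun a => {x | ∀ m < ℓ a, x ∈ U (a, m)} := by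
  obtain ⟨R, hR, h⟩ := hU.exists_rel
  -- The intersection is the union of the ideal balls that are formally inside some ball of each of
  -- the sets.
  have hI : REPred fun p : ℕ × ℕ => dist (s p.1.unpair.1) (s p.2.unpair.1) +
      posRatOf p.1.unpair.2 < posRatOf p.2.unpair.2 := by
    have u1 := Computable.unpair.comp (Computable.fst (α := ℕ) (β := ℕ))
    have u2 := Computable.unpair.comp (Computable.snd (α := ℕ) (β := ℕ))
    have h1 := hs.lowerSemicomputable_neg_dist.comp
      (Computable.pair (Computable.fst.comp u1) (Computable.fst.comp u2))
    have h2 := LowerSemicomputable.neg_posRatOf.comp (Computable.snd.comp u1)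
    have h3 := LowerSemicomputable.posRatOf.comp (Computable.snd.comp u2)
    exact LowerSemicomputable.lt ((h1.add h2).of_eq fun _ => (neg_add _ _).symm) h3
  have c1 : Computable fun y : ((α × ℕ) × ℕ) × ℕ => ((y.1.1.1, y.1.2), y.2) :=
    Computable.pair (Computable.pair (Computable.fst.comp (Computable.fst.comp Computable.fst))
      (Computable.snd.comp Computable.fst)) Computable.snd
  have c2 : Computable fun y : ((α × ℕ) × ℕ) × ℕ => (y.1.1.2, y.2) :=
    Computable.pair (Computable.snd.comp (Computable.fst.comp Computable.fst)) Computable.snd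
  refine REOpen.of_rel
    (((hR.comp c1).and (hI.comp c2)).exists_snd.forall_lt (hℓ.comp Computable.fst)) fun a x => ?_
  simp only [h, Set.mem_ofPred_eq]
  constructor
  · intro hx
    choose! n hn hxn using hx
    -- Finitely many balls around `x` leave a common positive margin.
    obtain ⟨ε, hε, hεn⟩ : ∃ ε : ℝ, 0 < ε ∧ ∀ m < ℓ a,
        ε ≤ posRatOf (n m).unpair.2 - dist x (s (n m).unpair.1) := by
      generalize ℓ a = k at hn hxn
      induction k with
      | zero => exact ⟨1, one_pos, by simp⟩
      | succ k ih =>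
        obtain ⟨ε, hε, hεn⟩ := ih (fun m hm => hn m (by omega)) fun m hm => hxn m (by omega)
        have := hxn k (by omega)
        rw [idealBall, Metric.mem_ball] at this
        refine ⟨min ε (posRatOf (n k).unpair.2 - dist x (s (n k).unpair.1)),
          lt_min hε (sub_pos.2 this), fun m hm => ?_⟩
        rcases Nat.lt_succ_iff_lt_or_eq.1 hm with hm | rfl
        · exact (min_le_left _ _).trans (hεn m hm)
        · exact min_le_right _ _
    obtain ⟨k, hk, hk'⟩ := exists_mem_idealBall hs.dense x (half_pos hε)
    refine ⟨k, fun m hm => ⟨n m, hn m hm, ?_⟩, hk⟩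
    rw [idealBall, Metric.mem_ball] at hk
    linarith [dist_triangle_left (s k.unpair.1) (s (n m).unpair.1) x, hεn m hm]
  · rintro ⟨k, hk, hx⟩ m hm
    obtain ⟨n, hn, hkn⟩ := hk m hm
    refine ⟨n, hn, ?_⟩
    rw [idealBall, Metric.mem_ball] at hx ⊢
    linarith [dist_triangle x (s k.unpair.1) (s n.unpair.1)]

end metric

/-! ### Lower semicomputability of the measure of r.e. open sets -/

/-- Multiplicities in a list realize the prescribed weights `k i`. -/
theorem exists_list_countP (k : ℕ → ℕ) (N : ℕ) : ∃ l : List ℕ, ∀ p : ℕ → Bool,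
    l.countP p = ∑ i ∈ (Finset.range N).filter (fun i => p i), k i := by
  induction N with
  | zero => exact ⟨[], by simp⟩
  | succ N ih =>
    obtain ⟨l, hl⟩ := ih
    refine ⟨List.replicate (k N) N ++ l, fun p => ?_⟩
    rw [List.countP_append, hl, List.countP_replicate, Finset.range_add_one, Finset.filter_insert]
    split_ifs with h
    · rw [Finset.sum_insert (by simp)]
    · simp

/-- Continuity from below, at a stage so late that a margin tending to zero is absorbed as well. -/
theorem exists_lt_measureReal_of_monotone {X : Type*} [MeasurableSpace X] {μ : Measure X}
    [IsFiniteMeasure μ] {V : ℕ → Set X}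
    (hV : Monotone V) {q : ℝ} (hq : q < μ.real (⋃ m, V m)) :
    ∃ m : ℕ, q + 2 / ((m : ℝ) + 1) < μ.real (V m) := by
  have h1 : Filter.Tendsto (fun m => μ.real (V m)) Filter.atTop (nhds (μ.real (⋃ m, V m))) :=
    (ENNReal.tendsto_toReal (measure_ne_top _ _)).comp (tendsto_measure_iUnion_atTop hV)
  have h2 : Filter.Tendsto (fun m : ℕ => q + 2 / ((m : ℝ) + 1)) Filter.atTop (nhds (q + 0)) := by
    refine tendsto_const_nhds.add ?_
    have := (tendsto_one_div_add_atTop_nhds_zero_nat (𝕜 := ℝ)).const_mul 2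
    simpa only [mul_one_div, mul_zero] using this
  rw [add_zero] at h2
  exact (h2.eventually_lt h1 hq).exists

section measure

variable {X : Type*} [MetricSpace X] [MeasurableSpace X] [BorelSpace X] {s : ℕ → X}

/-- The ideal measures are dense. -/
theorem exists_idealMeasure_dist_lt (hs : DenseRange s) (μ : ProbabilityMeasure X) {δ : ℝ}
    (hδ : 0 < δ) : ∃ n, dist (LevyProkhorov.ofMeasure μ) (idealMeasure s n) < δ := by
  classical
  -- One `ε` is for the mass outside the first `N` pieces, one for rounding the weights to multiples
  -- of `1 / M`, and one makes the final inequality strict.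
  obtain ⟨ε, hε, hεδ⟩ : ∃ ε : ℝ, 0 < ε ∧ 3 * ε = δ := ⟨δ / 3, by positivity, by ring⟩
  let A : ℕ → Set X := disjointed fun i => Metric.ball (s i) ε
  have hAm : ∀ i, MeasurableSet (A i) :=
    MeasurableSet.disjointed fun i => Metric.isOpen_ball.measurableSet
  have hAd : Pairwise (Function.onFun Disjoint A) := disjoint_disjointed _
  have hAu : ⋃ i, A i = Set.univ := by
    rw [iUnion_disjointed]
    refine Set.eq_univ_of_forall fun x => ?_
    obtain ⟨i, hi⟩ := Metric.denseRange_iff.1 hs x ε hε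
    exact Set.mem_iUnion.2 ⟨i, hi⟩
  have hsum : HasSum (fun i => (μ : Measure X).real (A i)) 1 := by
    have h := measure_iUnion (μ := (μ : Measure X)) hAd hAm
    rw [hAu, measure_univ] at h
    have := ENNReal.hasSum_toReal (f := fun i => (μ : Measure X) (A i)) (by rw [← h]; simp)
    rwa [← ENNReal.tsum_toReal_eq fun i => measure_ne_top _ _, ← h, ENNReal.toReal_one] at this
  obtain ⟨N, hN⟩ : ∃ N, 1 - ε < ∑ i ∈ Finset.range N, (μ : Measure X).real (A i) :=
    (hsum.tendsto_sum_nat.eventually (lt_mem_nhds (by linarith))).exists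
  have hN1 : ∑ i ∈ Finset.range N, (μ : Measure X).real (A i) ≤ 1 :=
    sum_le_hasSum _ (fun _ _ => measureReal_nonneg) hsum
  obtain ⟨M, hM⟩ := exists_nat_gt (N / ε)
  have hM0 : (0 : ℝ) < M := lt_of_le_of_lt (by positivity) hM
  rw [div_lt_iff₀ hε] at hM
  -- The mass of the piece `A i` is moved to `s i`, rounded down. Rounding costs at most one unit `1
  -- / M` per piece, hence at most `N / M < ε` in all.
  set k : ℕ → ℕ := fun i => ⌊(M : ℝ) * (μ : Measure X).real (A i)⌋₊ with hk
  have hk1 : ∀ i, (k i : ℝ) ≤ M * (μ : Measure X).real (A i) := fun i =>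
    Nat.floor_le (by positivity)
  have hk2 : ∀ i, M * (μ : Measure X).real (A i) - 1 ≤ k i := fun i => (Nat.sub_one_lt_floor _).le
  set K := ∑ i ∈ Finset.range N, k i with hKdef
  have hK1 : (K : ℝ) ≤ M := by
    rw [hKdef]
    push_cast
    refine (Finset.sum_le_sum fun i _ => hk1 i).trans ?_
    rw [← Finset.mul_sum]
    exact mul_le_of_le_one_right hM0.le hN1
  have hK2 : M * (1 - 2 * ε) ≤ K := by
    have h1 : (M : ℝ) * ∑ i ∈ Finset.range N, (μ : Measure X).real (A i) - N ≤ K := by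
      rw [hKdef]
      push_cast
      refine le_trans (le_of_eq ?_) (Finset.sum_le_sum fun i _ => hk2 i)
      rw [Finset.sum_sub_distrib, Finset.mul_sum]
      simp
    nlinarith
  have hKM : K ≤ M := by exact_mod_cast hK1
  obtain ⟨l, hl⟩ := exists_list_countP k N
  -- The missing mass is put at `s 0`. It is at most `2 * ε`, so its place is irrelevant.
  set L := List.replicate (M - K) 0 ++ l with hLdef
  have hLlen : L.length = M := by
    have : l.length = K := by
      have := hl fun _ => true
      simpa using this
    rw [hLdef, List.length_append, List.length_replicate, this]
    omega
  have hL0 : L ≠ [] := by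
    rintro h
    rw [h, List.length_nil] at hLlen
    rw [← hLlen] at hM0
    simp at hM0
  obtain ⟨n, hn⟩ : ∃ n, idealList n = L := by
    obtain ⟨a, t, ht⟩ := List.exists_cons_of_ne_nil hL0
    exact ⟨Nat.pair a (Encodable.encode t), by simp [idealList, ht]⟩
  refine ⟨n, ?_⟩
  have := isProbabilityMeasure_listMeasure s hL0
  rw [dist_comm, LevyProkhorov.dist_probabilityMeasure_def]
  change levyProkhorovDist (listMeasure s (idealList n)) (μ : Measure X) < δ
  rw [hn]
  refine lt_of_le_of_lt (b := 2 * ε) (levyProkhorovDist_le_of_forall_le _ _ (by positivity)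
    fun η B hη hB => ?_) (by linarith)
  rw [listMeasure_apply s hL0 hB, hLlen, ← List.countP_eq_length_filter]
  set J := (Finset.range N).filter fun i => s i ∈ B
  have hcount : (L.countP fun i => decide (s i ∈ B)) ≤ (M - K) + ∑ i ∈ J, k i := by
    rw [hLdef, List.countP_append, hl]
    refine add_le_add (List.countP_le_length.trans (by simp)) (le_of_eq ?_)
    congr 1
    simp [J]
  have hJ : ∑ i ∈ J, (μ : Measure X).real (A i) ≤ (μ : Measure X).real (Metric.thickening η B) := by
    rw [← measureReal_biUnion_finset (fun i _ j _ hij => hAd hij) fun i _ => hAm i]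
    refine measureReal_mono (Set.iUnion₂_subset fun i hi x hx => ?_)
    refine Metric.mem_thickening_iff.2 ⟨s i, (Finset.mem_filter.1 hi).2, ?_⟩
    have := disjointed_subset (fun i => Metric.ball (s i) ε) i hx
    rw [Metric.mem_ball] at this
    linarith
  rw [← ofReal_measureReal, ← ENNReal.ofReal_add measureReal_nonneg (by linarith)]
  refine ENNReal.ofReal_le_ofReal ((div_le_iff₀ hM0).2 ?_)
  calc ((L.countP fun i => decide (s i ∈ B) : ℕ) : ℝ)
      ≤ (M - K) + ∑ i ∈ J, (k i : ℝ) := by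
        rw [← Nat.cast_sub hKM]; exact_mod_cast hcount
    _ ≤ (M - K) + ∑ i ∈ J, M * (μ : Measure X).real (A i) := by gcongr with i; exact hk1 i
    _ ≤ _ := by rw [← Finset.mul_sum]; nlinarith

/-- The right side is a finite certificate: an ideal measure within `δ = 1 / (m + 1)` of `μ`, and a
part of its atoms, of weight above `q + δ`, whose `δ`-neighbourhoods are formally inside the open
set. By the definition of the Prokhorov metric that set then has measure above `q`. A certificate is
found by shrinking the balls first. -/
theorem lt_measureReal_iff (hs : DenseRange s) (μ : ProbabilityMeasure X) (E : Set ℕ) (q : ℝ) :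
    q < (μ : Measure X).real (⋃ n ∈ E, idealBall s n) ↔ ∃ (n : ℕ) (A : List ℕ) (m : ℕ),
      (A ∈ (idealList n).sublists' ∧
        dist (LevyProkhorov.ofMeasure μ) (idealMeasure s n) < 1 / ((m : ℝ) + 1)) ∧
      q + 1 / ((m : ℝ) + 1) < A.length / (idealList n).length ∧
      ∀ i ∈ A, ∃ k, k ∈ E ∧
        dist (s i) (s k.unpair.1) + 1 / ((m : ℝ) + 1) < posRatOf k.unpair.2 := by
  classical
  constructor
  · intro hq
    -- The radii lose `2 * δ`: one `δ` for the thickening, one for the margin required by the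
    -- certificate. The mass similarly needs an excess of `2 * δ`, for the Prokhorov error and for
    -- the margin in `q + δ`.
    let V : ℕ → Set X := fun m => ⋃ n ∈ E,
      Metric.ball (s n.unpair.1) (posRatOf n.unpair.2 - 2 / ((m : ℝ) + 1))
    have hVmono : Monotone V := fun a b hab => by
      refine Set.iUnion₂_mono fun n _ => Metric.ball_subset_ball ?_
      gcongr
    have hVU : ⋃ m, V m = ⋃ n ∈ E, idealBall s n := by
      ext x
      simp only [V, Set.mem_iUnion, idealBall, Metric.mem_ball]
      constructor
      · rintro ⟨m, n, hn, h⟩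
        have : (0 : ℝ) < 2 / ((m : ℝ) + 1) := by positivity
        exact ⟨n, hn, by linarith⟩
      · rintro ⟨n, hn, h⟩
        obtain ⟨m, hm⟩ := exists_nat_one_div_lt (half_pos (sub_pos.2 h))
        refine ⟨m, n, hn, ?_⟩
        rw [show (2 : ℝ) / ((m : ℝ) + 1) = 2 * (1 / ((m : ℝ) + 1)) by ring]
        linarith
    rw [← hVU] at hq
    obtain ⟨m, hm⟩ := exists_lt_measureReal_of_monotone hVmono hq
    have hδ : (0 : ℝ) < 1 / ((m : ℝ) + 1) := by positivity
    obtain ⟨n, hn⟩ := exists_idealMeasure_dist_lt hs μ hδ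
    set δ := 1 / ((m : ℝ) + 1) with hδdef
    rw [show (2 : ℝ) / ((m : ℝ) + 1) = 2 * δ by rw [hδdef]; ring] at hm
    set L := idealList n with hL
    have hL0 : L ≠ [] := List.cons_ne_nil _ _
    have := isProbabilityMeasure_listMeasure s hL0
    let W : Set X := ⋃ n ∈ E, Metric.ball (s n.unpair.1) (posRatOf n.unpair.2 - δ)
    have hW : MeasurableSet W := (isOpen_biUnion fun _ _ => Metric.isOpen_ball).measurableSet
    have hVm : MeasurableSet (V m) := (isOpen_biUnion fun _ _ => Metric.isOpen_ball).measurableSet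
    have hE : levyProkhorovEDist (μ : Measure X) (listMeasure s L) < ENNReal.ofReal δ := by
      refine (ENNReal.lt_ofReal_iff_toReal_lt (levyProkhorovEDist_ne_top _ _)).2 ?_
      rw [LevyProkhorov.dist_probabilityMeasure_def] at hn
      exact hn
    refine ⟨n, L.filter fun i => decide (s i ∈ W), m,
      ⟨List.mem_sublists'.2 List.filter_sublist, hn⟩, ?_, ?_⟩
    · have h1 := left_measure_le_of_levyProkhorovEDist_lt hE hVm
      rw [ENNReal.toReal_ofReal hδ.le] at h1
      have h2 : Metric.thickening δ (V m) ⊆ W := by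
        intro x hx
        obtain ⟨y, hy, hxy⟩ := Metric.mem_thickening_iff.1 hx
        simp only [V, W, Set.mem_iUnion, Metric.mem_ball] at hy ⊢
        obtain ⟨k, hk, h⟩ := hy
        refine ⟨k, hk, ?_⟩
        rw [show (2 : ℝ) / ((m : ℝ) + 1) = 2 * δ by rw [hδdef]; ring] at h
        linarith [dist_triangle x y (s k.unpair.1)]
      have h3 := h1.trans (add_le_add_left (measure_mono h2) _)
      rw [listMeasure_apply s hL0 hW, ← ENNReal.ofReal_add (by positivity) hδ.le,
        ← ofReal_measureReal (measure_ne_top _ _),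
        ENNReal.ofReal_le_ofReal_iff (by positivity)] at h3
      linarith
    · intro i hi
      have : s i ∈ W := by simpa using (List.mem_filter.1 hi).2
      simp only [W, Set.mem_iUnion, Metric.mem_ball] at this
      obtain ⟨k, hk, h⟩ := this
      exact ⟨k, hk, by linarith⟩
  · rintro ⟨n, A, m, ⟨hA, hn⟩, hq, hAE⟩
    have hδ : (0 : ℝ) < 1 / ((m : ℝ) + 1) := by positivity
    set δ := 1 / ((m : ℝ) + 1) with hδdef
    set L := idealList n with hL
    have hL0 : L ≠ [] := List.cons_ne_nil _ _
    have := isProbabilityMeasure_listMeasure s hL0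
    have hE : levyProkhorovEDist (μ : Measure X) (listMeasure s L) < ENNReal.ofReal δ := by
      refine (ENNReal.lt_ofReal_iff_toReal_lt (levyProkhorovEDist_ne_top _ _)).2 ?_
      rw [LevyProkhorov.dist_probabilityMeasure_def] at hn
      exact hn
    let B : Set X := s '' {i | i ∈ A}
    have hB : MeasurableSet B := ((List.finite_toSet A).image _).measurableSet
    have h1 := right_measure_le_of_levyProkhorovEDist_lt hE hB
    rw [ENNReal.toReal_ofReal hδ.le, listMeasure_apply s hL0 hB] at h1
    have hlen : A.length ≤ (L.filter fun i => decide (s i ∈ B)).length := by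
      have hs := (List.mem_sublists'.1 hA).filter fun i => decide (s i ∈ B)
      rw [List.filter_eq_self.2 fun i hi => decide_eq_true ⟨i, hi, rfl⟩] at hs
      exact hs.length_le
    have h2 : Metric.thickening δ B ⊆ ⋃ n ∈ E, idealBall s n := by
      intro x hx
      obtain ⟨_, ⟨i, hi, rfl⟩, hxy⟩ := Metric.mem_thickening_iff.1 hx
      obtain ⟨k, hk, h⟩ := hAE i hi
      refine Set.mem_biUnion hk ?_
      rw [idealBall, Metric.mem_ball]
      linarith [dist_triangle x (s i) (s k.unpair.1)]
    have h3 := h1.trans (add_le_add_left (measure_mono h2) _)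
    rw [← ofReal_measureReal (measure_ne_top _ _), ← ENNReal.ofReal_add (by positivity) hδ.le,
      ENNReal.ofReal_le_ofReal_iff (by positivity)] at h3
    have h4 : (A.length : ℝ) / L.length ≤
        (L.filter fun i => decide (s i ∈ B)).length / L.length := by gcongr
    linarith

/-- Computability of `μ` enters the proof here: it makes closeness to an ideal measure r.e. The
other clauses of the certificate are r.e. by the computability of the metric and of the family. -/
theorem IsComputableProbabilitySpace.lowerSemicomputable_measureReal {μ : ProbabilityMeasure X}
    (h : IsComputableProbabilitySpace s μ) {U : α → Set X} (hU : REOpen s U) :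
    LowerSemicomputable fun a => (μ : Measure X).real (U a) := by
  obtain ⟨E, hE, hU⟩ := hU
  have hs := h.metric
  have c1 : Computable fun y : (α × ℕ) × ℕ × List ℕ × ℕ => y.2.1 :=
    Computable.fst.comp Computable.snd
  have c2 : Computable fun y : (α × ℕ) × ℕ × List ℕ × ℕ => y.2.2.1 :=
    Computable.fst.comp (Computable.snd.comp Computable.snd)
  have c3 : Computable fun y : (α × ℕ) × ℕ × List ℕ × ℕ => y.2.2.2 :=
    Computable.snd.comp (Computable.snd.comp Computable.snd)
  have c4 : Computable fun y : (α × ℕ) × ℕ × List ℕ × ℕ => y.1.1 :=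
    Computable.fst.comp Computable.fst
  have c5 : Computable fun y : (α × ℕ) × ℕ × List ℕ × ℕ => y.1.2 :=
    Computable.snd.comp Computable.fst
  have r1 : REPred fun y : (α × ℕ) × ℕ × List ℕ × ℕ => y.2.2.1 ∈ (idealList y.2.1).sublists' := by
    have : PrimrecRel fun (l : List (List ℕ)) (A : List ℕ) => ∃ B ∈ l, B = A :=
      PrimrecRel.exists_mem_list Primrec.eq
    refine ((REPred.of_primrecPred (this.comp (Primrec.fst (α := List (List ℕ)) (β := List ℕ))
      Primrec.snd)).comp (Computable.pair
        ((primrec_sublists.comp primrec_idealList).to_comp.comp c1) c2)).of_eq fun y => ?_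
    simp
  have r2 : REPred fun y : (α × ℕ) × ℕ × List ℕ × ℕ =>
      dist (LevyProkhorov.ofMeasure μ) (idealMeasure s y.2.1) < 1 / ((y.2.2.2 : ℝ) + 1) := by
    refine (REPred.comp h.measure (Primrec₂.natPair.to_comp.comp c1
      (Primrec₂.natPair.to_comp.comp (Computable.const 0) c3))).of_eq fun y => ?_
    simp [idealBall, posRatOf_pair]
  have r3 : REPred fun y : (α × ℕ) × ℕ × List ℕ × ℕ =>
      (ratOf y.1.2 : ℝ) + 1 / ((y.2.2.2 : ℝ) + 1) < y.2.2.1.length / (idealList y.2.1).length := by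
    have h1 := (LowerSemicomputable.neg_ratOf.comp c5).add (LowerSemicomputable.neg_natCast_div (Computable.const 1) c3)
    have h2 := LowerSemicomputable.natCast_div (Computable.list_length.comp c2)
      (Computable.pred.comp (Computable.list_length.comp (primrec_idealList.to_comp.comp c1)))
    refine (h1.add h2).pos.of_eq fun y => ?_
    have : (((idealList y.2.1).length.pred : ℕ) : ℝ) + 1 = (idealList y.2.1).length := by
      simp [idealList]
    rw [this]
    simp only [Nat.cast_one]
    constructor <;> intro h <;> linarith
  have r4 : REPred fun z : ℕ × α × ℕ => ∃ k, k ∈ E z.2.1 ∧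
      dist (s z.1) (s k.unpair.1) + 1 / ((z.2.2 : ℝ) + 1) < posRatOf k.unpair.2 := by
    have d1 : Computable fun w : (ℕ × α × ℕ) × ℕ => w.1.1 := Computable.fst.comp Computable.fst
    have d2 : Computable fun w : (ℕ × α × ℕ) × ℕ => w.1.2.1 :=
      Computable.fst.comp (Computable.snd.comp Computable.fst)
    have d3 : Computable fun w : (ℕ × α × ℕ) × ℕ => w.1.2.2 :=
      Computable.snd.comp (Computable.snd.comp Computable.fst)
    have d4 : Computable fun w : (ℕ × α × ℕ) × ℕ => w.2.unpair := Computable.unpair.comp Computable.snd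
    have h1 := (hs.lowerSemicomputable_neg_dist.comp
      (Computable.pair d1 (Computable.fst.comp d4))).add
      (LowerSemicomputable.neg_natCast_div (Computable.const 1) d3)
    have h2 := LowerSemicomputable.posRatOf.comp (Computable.snd.comp d4)
    have h3 := (hE.comp (Computable.pair d2 Computable.snd)).and (h1.add h2).pos
    refine h3.exists_snd.of_eq fun z => exists_congr fun k => and_congr_right fun _ => ?_
    simp only [Nat.cast_one]
    constructor <;> intro h <;> linarith
  have r5 := r4.forall_mem_list.comp (Computable.pair c2 (Computable.pair c4 c3))
  refine ((r1.and r2).and (r3.and r5)).exists_snd.of_eq fun ⟨a, q⟩ => ?_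
  simp only [hU, lt_measureReal_iff hs.dense, Prod.exists]

end measure

/-! ### Almost decidable balls -/

/-- The left end point of the rational interval with code `⟨p, w⟩`, the interval of length `w`
that starts at `p`. -/
noncomputable def gapLeft (c : ℕ) : ℝ := posRatOf c.unpair.1

/-- The right end point of the rational interval with code `⟨p, w⟩`. -/
noncomputable def gapRight (c : ℕ) : ℝ := posRatOf c.unpair.1 + posRatOf c.unpair.2

theorem gapLeft_lt_gapRight (c : ℕ) : gapLeft c < gapRight c :=
  lt_add_of_pos_right _ (posRatOf_pos _)

theorem lowerSemicomputable_gapLeft : LowerSemicomputable gapLeft :=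
  LowerSemicomputable.posRatOf.comp (Computable.fst.comp Computable.unpair)

theorem lowerSemicomputable_neg_gapLeft : LowerSemicomputable fun c => -gapLeft c :=
  LowerSemicomputable.neg_posRatOf.comp (Computable.fst.comp Computable.unpair)

theorem lowerSemicomputable_gapRight : LowerSemicomputable gapRight :=
  (LowerSemicomputable.posRatOf.comp (Computable.fst.comp Computable.unpair)).add
    (LowerSemicomputable.posRatOf.comp (Computable.snd.comp Computable.unpair))

theorem lowerSemicomputable_neg_gapRight : LowerSemicomputable fun c => -gapRight c :=
  ((LowerSemicomputable.neg_posRatOf.comp (Computable.fst.comp Computable.unpair)).add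
    (LowerSemicomputable.neg_posRatOf.comp (Computable.snd.comp Computable.unpair))).of_eq
      fun _ => (neg_add _ _).symm

theorem exists_computable_gap : ∃ c : ℕ → ℕ, Computable c ∧
    (∀ k, gapRight (c k) = 1 / ((k.unpair.2 : ℝ) + 1)) ∧
    ∀ k, gapLeft (c k) = 1 / (2 * ((k.unpair.2 : ℝ) + 1)) := by
  -- The number `1 / (2 * (j + 1))`, with code `⟨0, 2 * j + 1⟩`, is both the left end and the
  -- length.
  refine ⟨fun k => Nat.pair (Nat.pair 0 (2 * k.unpair.2 + 1)) (Nat.pair 0 (2 * k.unpair.2 + 1)),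
    ?_, fun k => ?_, fun k => ?_⟩
  · have h1 : Primrec fun k : ℕ => Nat.pair 0 (2 * k.unpair.2 + 1) :=
      Primrec₂.natPair.comp (Primrec.const 0) (Primrec.nat_double_succ.comp
        (Primrec.snd.comp Primrec.unpair))
    exact (Primrec₂.natPair.comp h1 h1).to_comp
  · simp only [gapRight, Nat.unpair_pair, posRatOf_pair]
    push_cast
    field_simp
    ring
  · simp only [gapLeft, Nat.unpair_pair, posRatOf_pair]
    push_cast
    ring_nf

theorem exists_computable_iterate {f : ℕ × ℕ × ℕ → ℕ} (hf : Computable f) {c : ℕ → ℕ}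
    (hc : Computable c) : ∃ g : ℕ × ℕ → ℕ, Computable g ∧ (∀ k, g (k, 0) = c k) ∧
      ∀ k n, g (k, n + 1) = f (k, n, g (k, n)) := by
  refine ⟨fun p => Nat.rec (c p.1) (fun n a => f (p.1, n, a)) p.2, ?_, fun _ => rfl, fun _ _ => rfl⟩
  refine Computable.nat_rec (h := fun (p : ℕ × ℕ) (q : ℕ × ℕ) => f (p.1, q.1, q.2))
    Computable.snd (hc.comp Computable.fst) ?_
  exact hf.comp (Computable.pair (Computable.fst.comp Computable.fst) Computable.snd)

section

variable {X : Type*} [MetricSpace X] [MeasurableSpace X] [BorelSpace X] {s : ℕ → X}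

/-- The distribution of the distance to `y` has only countably many atoms, so some radius `r` in the
given interval has a null sphere. Outer regularity then gives a rational interval around `r` that
carries little mass. -/
theorem exists_gap (μ : ProbabilityMeasure X) (y : X) (n c : ℕ) : ∃ c',
    gapLeft c < gapLeft c' ∧ gapRight c' < gapRight c ∧
      1 - 1 / ((n : ℝ) + 1) <
        (μ : Measure X).real (Metric.ball y (gapLeft c') ∪ {x | gapRight c' < dist x y}) := by
  have hg : Measurable fun x : X => dist x y :=
    (continuous_id.dist continuous_const).measurable
  have hcount := Measure.countable_meas_level_set_pos (μ := (μ : Measure X)) hg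
  obtain ⟨r, hr0, hr⟩ := (hcount.dense_compl ℝ).exists_mem_open isOpen_Ioo
    (Set.nonempty_Ioo.2 (gapLeft_lt_gapRight c))
  have hr0 : (μ : Measure X).map (fun x => dist x y) {r} = 0 := by
    rw [Measure.map_apply hg (measurableSet_singleton r)]
    simpa [Set.preimage] using hr0
  have hn : (0 : ℝ) < 1 / ((n : ℝ) + 1) := by positivity
  have : IsProbabilityMeasure ((μ : Measure X).map fun x => dist x y) :=
    Measure.isProbabilityMeasure_map hg.aemeasurable
  obtain ⟨O, hrO, hO, hOμ⟩ := Set.exists_isOpen_lt_of_lt (μ := (μ : Measure X).map fun x => dist x y)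
    {r} (ENNReal.ofReal (1 / ((n : ℝ) + 1))) (by rw [hr0]; exact ENNReal.ofReal_pos.2 hn)
  obtain ⟨δ, hδ, hδO⟩ := Metric.isOpen_iff.1 hO r (hrO rfl)
  have hpos : 0 < gapLeft c := posRatOf_pos _
  obtain ⟨p, hp1, hp2⟩ := exists_posRatOf_btwn (hpos.le.trans (le_max_left _ (r - δ)))
    (max_lt hr.1 (by linarith))
  obtain ⟨w, hw1, hw2⟩ := exists_posRatOf_btwn (a := r - posRatOf p)
    (b := min (gapRight c) (r + δ) - posRatOf p) (by linarith)
    (sub_lt_sub_right (lt_min hr.2 (by linarith)) _)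
  have hl : gapLeft (Nat.pair p w) = posRatOf p := by simp [gapLeft]
  have hrt : gapRight (Nat.pair p w) = posRatOf p + posRatOf w := by simp [gapRight]
  refine ⟨Nat.pair p w, ?_, ?_, ?_⟩
  · rw [hl]
    exact (le_max_left _ _).trans_lt hp1
  · rw [hrt]
    linarith [min_le_left (gapRight c) (r + δ)]
  · rw [hl, hrt]
    have hsub : ((fun x => dist x y) ⁻¹' O)ᶜ ⊆
        Metric.ball y (posRatOf p) ∪ {x | (posRatOf p : ℝ) + posRatOf w < dist x y} := by
      intro x hx
      by_contra hcon
      simp only [Set.mem_union, Metric.mem_ball, Set.mem_ofPred_eq, not_or, not_lt] at hcon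
      refine hx (hδO ?_)
      rw [Metric.mem_ball, Real.dist_eq, abs_lt]
      constructor
      · linarith [le_max_right (gapLeft c) (r - δ), hcon.1]
      · linarith [min_le_right (gapRight c) (r + δ), hcon.2]
    refine lt_of_lt_of_le ?_ (measureReal_mono hsub)
    rw [probReal_compl_eq_one_sub (hg hO.measurableSet)]
    rw [Measure.map_apply hg hO.measurableSet] at hOμ
    have := (ENNReal.lt_ofReal_iff_toReal_lt (measure_ne_top _ _)).1 hOμ
    exact sub_lt_sub_left this _

/-- All three conditions are strict inequalities that are r.e. by lower semicomputability, so a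
refinement can be found by search. -/
theorem IsComputableProbabilitySpace.exists_computable_gap_refinement {μ : ProbabilityMeasure X}
    (hX : IsComputableProbabilitySpace s μ) : ∃ f : ℕ × ℕ × ℕ → ℕ, Computable f ∧ ∀ y,
      gapLeft y.2.2 < gapLeft (f y) ∧ gapRight (f y) < gapRight y.2.2 ∧
        1 - 1 / ((y.2.1 : ℝ) + 1) < (μ : Measure X).real
          (Metric.ball (s y.1.unpair.1) (gapLeft (f y)) ∪
            {x | gapRight (f y) < dist x (s y.1.unpair.1)}) := by
  have hs := hX.metric
  have c1 : Computable fun y : (ℕ × ℕ × ℕ) × ℕ => y.1.1.unpair.1 :=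
    Computable.fst.comp (Computable.unpair.comp (Computable.fst.comp Computable.fst))
  have c2 : Computable fun y : (ℕ × ℕ × ℕ) × ℕ => y.1.2.1 :=
    Computable.fst.comp (Computable.snd.comp Computable.fst)
  have c3 : Computable fun y : (ℕ × ℕ × ℕ) × ℕ => y.1.2.2 :=
    Computable.snd.comp (Computable.snd.comp Computable.fst)
  have c4 : Computable fun y : (ℕ × ℕ × ℕ) × ℕ => y.2 := Computable.snd
  have r1 := LowerSemicomputable.lt (lowerSemicomputable_neg_gapLeft.comp c3)
    (lowerSemicomputable_gapLeft.comp c4)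
  have r2 := LowerSemicomputable.lt (lowerSemicomputable_neg_gapRight.comp c4)
    (lowerSemicomputable_gapRight.comp c3)
  have o1 := (hs.reOpen_ball c1 (lowerSemicomputable_gapLeft.comp c4)).union
    (hs.reOpen_lt_dist c1 (lowerSemicomputable_neg_gapRight.comp c4))
  have r3 := LowerSemicomputable.lt (f := fun y : (ℕ × ℕ × ℕ) × ℕ => 1 - 1 / ((y.1.2.1 : ℝ) + 1))
    (((LowerSemicomputable.const_neg_nat 1).add
      (LowerSemicomputable.natCast_div (Computable.const 1) c2)).of_eq fun y => by
        simp only [Nat.cast_one]; ring)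
    (hX.lowerSemicomputable_measureReal o1)
  obtain ⟨f, hf, h⟩ := (r1.and (r2.and r3)).exists_computable fun y =>
    exists_gap μ (s y.1.unpair.1) y.2.1 y.2.2
  exact ⟨f, hf, h⟩

/-- There is a computable sequence of almost decidable balls: `U k` and `V k` are disjoint r.e.
open sets, uniformly in `k`, of total measure one. -/
theorem IsComputableProbabilitySpace.exists_almostDecidable {μ : ProbabilityMeasure X}
    (hX : IsComputableProbabilitySpace s μ) : ∃ U V : ℕ → Set X, REOpen s U ∧ REOpen s V ∧
      (∀ k, Disjoint (U k) (V k)) ∧ (∀ k, (μ : Measure X) (U k ∪ V k) = 1) ∧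
      (∀ k, U k ⊆ Metric.closedBall (s k.unpair.1) (1 / ((k.unpair.2 : ℝ) + 1))) ∧
      ∀ x j, ∃ i, x ∈ U (Nat.pair i j) := by
  have hs := hX.metric
  obtain ⟨f, hf, hfs⟩ := hX.exists_computable_gap_refinement
  obtain ⟨c0, hc0, hc0r, hc0l⟩ := exists_computable_gap
  obtain ⟨g, hg, hg0, hgs⟩ := exists_computable_iterate hf hc0
  have hmono : ∀ k, Monotone fun n => gapLeft (g (k, n)) := fun k =>
    monotone_nat_of_le_succ fun n => by rw [hgs]; exact (hfs (k, n, g (k, n))).1.le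
  have hanti : ∀ k, Antitone fun n => gapRight (g (k, n)) := fun k =>
    antitone_nat_of_succ_le fun n => by rw [hgs]; exact (hfs (k, n, g (k, n))).2.1.le
  have hlr : ∀ k m n, gapLeft (g (k, m)) < gapRight (g (k, n)) := fun k m n =>
    ((hmono k (le_max_left m n)).trans_lt (gapLeft_lt_gapRight _)).trans_le
      (hanti k (le_max_right m n))
  have ci : Computable fun p : ℕ × ℕ => p.1.unpair.1 :=
    Computable.fst.comp (Computable.unpair.comp Computable.fst)
  -- `U k` collects the balls up to the left ends, `V k` the exteriors of the right ends. The nested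
  -- gaps need not shrink to one radius; it suffices that the mass of their shells tends to zero.
  refine ⟨fun k => {x | ∃ n, x ∈ Metric.ball (s k.unpair.1) (gapLeft (g (k, n)))},
    fun k => {x | ∃ n, x ∈ {x | gapRight (g (k, n)) < dist x (s k.unpair.1)}},
    (hs.reOpen_ball ci (lowerSemicomputable_gapLeft.comp hg)).exists_snd,
    (hs.reOpen_lt_dist ci (r := fun p => gapRight (g p))
      (lowerSemicomputable_neg_gapRight.comp hg)).exists_snd, ?_, ?_, ?_, ?_⟩
  · refine fun k => Set.disjoint_left.2 ?_
    rintro x ⟨m, hm⟩ ⟨n, hn⟩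
    rw [Metric.mem_ball] at hm
    rw [Set.mem_ofPred_eq] at hn
    linarith [hlr k m n]
  · intro k
    refine le_antisymm prob_le_one ?_
    rw [← ofReal_measureReal (measure_ne_top _ _), ENNReal.one_le_ofReal]
    refine le_of_forall_pos_lt_add fun ε hε => ?_
    obtain ⟨n, hn⟩ := exists_nat_one_div_lt hε
    have h1 := (hfs (k, n, g (k, n))).2.2
    rw [← hgs] at h1
    have h2 := h1.trans_le (measureReal_mono (μ := (μ : Measure X)) (Set.union_subset_union
      (fun x hx => (⟨n + 1, hx⟩ : ∃ m, x ∈ Metric.ball (s k.unpair.1) (gapLeft (g (k, m)))))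
      (fun x hx => (⟨n + 1, hx⟩ : ∃ m, x ∈ {x | gapRight (g (k, m)) < dist x (s k.unpair.1)}))))
    have h3 : ∀ r : ℝ, 1 - 1 / ((n : ℝ) + 1) < r → 1 < r + ε := fun r hr => by linarith
    exact h3 _ h2
  · rintro k x ⟨n, hn⟩
    rw [Metric.mem_ball] at hn
    rw [Metric.mem_closedBall, ← hc0r, ← hg0]
    exact (hn.trans (hlr k n 0)).le
  · intro x j
    -- All gaps lie to the right of `1 / (2 * (j + 1))`, so `U ⟨i, j⟩` contains the ball of this
    -- radius around `s i`. Thus every point is covered, not just almost every point.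
    obtain ⟨i, hi⟩ := Metric.denseRange_iff.1 hs.dense x (1 / (2 * ((j : ℝ) + 1))) (by positivity)
    refine ⟨i, 0, ?_⟩
    rw [hg0, hc0l]
    simpa using hi

end

/-! ### Cylinders -/

section cylinders

variable {X : Type*}

/-- The set of the points whose itinerary through the pairs `S (true, k)`, `S (false, k)` of sets
begins with the word `w`; the last letter of the word is the head of the list. -/
def cyl (S : Bool × ℕ → Set X) : List Bool → Set X
  | [] => Set.univ
  | b :: w => cyl S w ∩ S (b, w.length)

/-- The union of the cylinders of the words of the length of `w` that are smaller (for `c = true`)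
or larger (for `c = false`) than `w` in the lexicographic order. -/
def beside (S : Bool × ℕ → Set X) (c : Bool) : List Bool → Set X
  | [] => ∅
  | b :: w => beside S c w ∪ {x | b = c ∧ x ∈ cyl S ((!c) :: w)}

/-- The initial segment of length `n` of the sequence `β`, in reverse order. -/
def initSeg (β : ℕ → Bool) : ℕ → List Bool
  | 0 => []
  | n + 1 => β n :: initSeg β n

@[simp]
theorem length_initSeg (β : ℕ → Bool) (n : ℕ) : (initSeg β n).length = n := by
  induction n with
  | zero => rfl
  | succ n ih => simp [initSeg, ih]

variable {S : Bool × ℕ → Set X}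

theorem cyl_cons_subset (b : Bool) (w : List Bool) : cyl S (b :: w) ⊆ cyl S w :=
  Set.inter_subset_left

theorem cyl_initSeg_succ_subset (β : ℕ → Bool) (n : ℕ) : cyl S (initSeg β (n + 1)) ⊆ S (β n, n) :=
  fun _ hx => by simpa using hx.2

theorem antitone_cyl_initSeg (β : ℕ → Bool) : Antitone fun n => cyl S (initSeg β n) :=
  antitone_nat_of_succ_le fun _ => cyl_cons_subset _ _

theorem mem_cyl_initSeg {β : ℕ → Bool} {x : X} (h : ∀ k, x ∈ S (β k, k)) (n : ℕ) :
    x ∈ cyl S (initSeg β n) := by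
  induction n with
  | zero => trivial
  | succ n ih => exact ⟨ih, by simpa using h n⟩

/-- Letters are numbered from the beginning of the word, list entries from its end. The bounded
quantifier is the form required by `reOpen_forall_lt`. -/
theorem mem_cyl_iff_forall_lt {w : List Bool} {x : X} : x ∈ cyl S w ↔
    ∀ m < w.length, x ∈ S (w.getD m false, w.length - (m + 1)) := by
  induction w with
  | nil => simp [cyl]
  | cons b w ih =>
    rw [cyl, Set.mem_inter_iff, ih]
    constructor
    · rintro ⟨h1, h2⟩ m hm
      cases m with
      | zero => simpa using h2
      | succ m =>
        have := h1 m (by simpa using hm)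
        simpa using this
    · intro h
      refine ⟨fun m hm => ?_, by simpa using h 0 (by simp)⟩
      have := h (m + 1) (by simpa using hm)
      simpa using this

/-- Words on the side `c` are sorted by the first position where they differ from `w`; the common
beginning is `w.drop (m + 1)`. This displays the set as an r.e. union of cylinders. -/
theorem mem_beside_iff_exists {c : Bool} {w : List Bool} {x : X} : x ∈ beside S c w ↔
    ∃ m, (m < w.length ∧ w.getD m false = c) ∧ x ∈ cyl S ((!c) :: w.drop (m + 1)) := by
  induction w with
  | nil => simp [beside]
  | cons b w ih =>
    rw [beside, Set.mem_union, ih]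
    constructor
    · rintro (⟨m, ⟨h1, h2⟩, h3⟩ | ⟨h1, h2⟩)
      · exact ⟨m + 1, ⟨by simpa using h1, by simpa using h2⟩, h3⟩
      · exact ⟨0, ⟨by simp, by simpa using h1⟩, h2⟩
    · rintro ⟨m, ⟨h1, h2⟩, h3⟩
      cases m with
      | zero => exact Or.inr ⟨by simpa using h2, h3⟩
      | succ m => exact Or.inl ⟨m, ⟨by simpa using h1, by simpa using h2⟩, h3⟩

theorem beside_cons_not (c : Bool) (w : List Bool) : beside S c ((!c) :: w) = beside S c w := by
  simp [beside]

end cylinders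

section reOpen

variable {X : Type*} [MetricSpace X] {s : ℕ → X} {S : Bool × ℕ → Set X}

theorem IsComputableMetricSpace.reOpen_cyl (hs : IsComputableMetricSpace s) (hS : REOpen s S) :
    REOpen s (cyl S) := by
  have c : Computable fun p : List Bool × ℕ => (p.1.getD p.2 false, p.1.length - (p.2 + 1)) :=
    (Primrec.pair (Primrec.list_getD false)
      (Primrec.nat_sub.comp (Primrec.list_length.comp Primrec.fst)
        (Primrec.succ.comp Primrec.snd))).to_comp
  refine (hs.reOpen_forall_lt (hS.comp c) Computable.list_length).of_eq fun w => ?_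
  ext x
  exact mem_cyl_iff_forall_lt.symm

theorem IsComputableMetricSpace.reOpen_beside (hs : IsComputableMetricSpace s)
    (hS : REOpen s S) (c : Bool) : REOpen s (beside S c) := by
  have h1 : Computable fun p : List Bool × ℕ => (!c) :: p.1.drop (p.2 + 1) :=
    (Primrec.list_cons.comp (Primrec.const _)
      (Primrec.list_drop.comp (Primrec.succ.comp Primrec.snd) Primrec.fst)).to_comp
  have h2 : PrimrecPred fun p : List Bool × ℕ => p.2 < p.1.length ∧ p.1.getD p.2 false = c :=
    (Primrec.nat_lt.comp Primrec.snd (Primrec.list_length.comp Primrec.fst)).and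
      (Primrec.eq.comp (Primrec.list_getD false) (Primrec.const c))
  refine (((hs.reOpen_cyl hS).comp h1).exists_and (REPred.of_primrecPred h2)).of_eq fun w => ?_
  ext x
  exact mem_beside_iff_exists.symm

end reOpen

/-- `S (true, k)` and `S (false, k)` are disjoint r.e. open sets, uniformly in `k`, that cover
almost all points, and the sets `S (true, k)` form a vanishing cover. -/
structure AlmostDecidable {X : Type*} [MetricSpace X] [MeasurableSpace X] (s : ℕ → X)
    (μ : ProbabilityMeasure X) (S : Bool × ℕ → Set X) : Prop where
  reOpen : REOpen s S
  disjoint : ∀ k, Disjoint (S (true, k)) (S (false, k))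
  full : ∀ k, (μ : Measure X) (S (true, k) ∪ S (false, k)) = 1
  small : ∀ k, S (true, k) ⊆ Metric.closedBall (s k.unpair.1) (1 / ((k.unpair.2 : ℝ) + 1))
  cover : ∀ x j, ∃ i, x ∈ S (true, Nat.pair i j)

/-! ### The intervals of the words. -/

section endpoints

variable {X : Type*} [MeasurableSpace X] {μ : ProbabilityMeasure X} {S : Bool × ℕ → Set X}

/-- The left end point of the interval that corresponds to the cylinder of `w`. -/
noncomputable def lo (μ : ProbabilityMeasure X) (S : Bool × ℕ → Set X) (w : List Bool) : ℝ :=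
  (μ : Measure X).real (beside S true w)

/-- The right end point of the interval that corresponds to the cylinder of `w`. -/
noncomputable def hi (μ : ProbabilityMeasure X) (S : Bool × ℕ → Set X) (w : List Bool) : ℝ :=
  1 - (μ : Measure X).real (beside S false w)

theorem lo_nonneg (w : List Bool) : 0 ≤ lo μ S w := measureReal_nonneg

theorem hi_le_one (w : List Bool) : hi μ S w ≤ 1 := sub_le_self _ measureReal_nonneg

theorem lo_false (w : List Bool) : lo μ S (false :: w) = lo μ S w := by
  rw [lo, lo, ← beside_cons_not true w, Bool.not_true]

theorem hi_true (w : List Bool) : hi μ S (true :: w) = hi μ S w := by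
  rw [hi, hi, ← beside_cons_not false w, Bool.not_false]

end endpoints

section

variable {X : Type*} [MetricSpace X] [MeasurableSpace X] {s : ℕ → X} {μ : ProbabilityMeasure X}
  {S : Bool × ℕ → Set X}

namespace AlmostDecidable

theorem isOpen (hS : AlmostDecidable s μ S) (p : Bool × ℕ) : IsOpen (S p) := hS.reOpen.isOpen p

theorem disjoint_of_ne (hS : AlmostDecidable s μ S) {b c : Bool} (h : b ≠ c) (k : ℕ) :
    Disjoint (S (b, k)) (S (c, k)) := by
  cases b <;> cases c <;> first | exact absurd rfl h | exact hS.disjoint k | exact (hS.disjoint k).symm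

theorem isOpen_cyl (hS : AlmostDecidable s μ S) (w : List Bool) : IsOpen (cyl S w) := by
  induction w with
  | nil => exact isOpen_univ
  | cons b w ih => exact ih.inter (hS.isOpen _)

theorem isOpen_beside (hS : AlmostDecidable s μ S) (c : Bool) (w : List Bool) :
    IsOpen (beside S c w) := by
  have : beside S c w = ⋃ m, ⋃ (_ : m < w.length ∧ w.getD m false = c),
      cyl S ((!c) :: w.drop (m + 1)) := by
    ext x
    simp only [mem_beside_iff_exists, Set.mem_iUnion, exists_prop]
  rw [this]
  exact isOpen_iUnion fun m => isOpen_iUnion fun _ => hS.isOpen_cyl _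

theorem disjoint_beside_cyl (hS : AlmostDecidable s μ S) (c : Bool) (w : List Bool) :
    Disjoint (beside S c w) (cyl S w) := by
  induction w with
  | nil => simp [beside]
  | cons b w ih =>
    refine Disjoint.union_left (ih.mono_right (cyl_cons_subset _ _)) ?_
    refine Set.disjoint_left.2 ?_
    rintro x ⟨rfl, h1⟩ h2
    exact Set.disjoint_left.1 (hS.disjoint_of_ne (Bool.not_ne_self b) _) h1.2 h2.2

/-- The intersection of the cylinders along a sequence has at most one point. -/
theorem subsingleton_iInter_cyl (hS : AlmostDecidable s μ S) (β : ℕ → Bool) {x y : X}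
    (hx : ∀ n, x ∈ cyl S (initSeg β n)) (hy : ∀ k, β k = true → y ∈ closure (S (true, k))) :
    x = y := by
  refine dist_le_zero.1 (le_of_forall_pos_le_add fun ε hε => ?_)
  obtain ⟨j, hj⟩ := exists_nat_one_div_lt (half_pos hε)
  -- At each scale `x` lies in a small set with letter `true`, which forces that letter in `β` and
  -- so puts `y` in the same closed ball. Hence for `y` only the closures at the letters `true`
  -- matter.
  obtain ⟨i, hi⟩ := hS.cover x j
  have hβ : β (Nat.pair i j) = true := by
    by_contra h
    exact Set.disjoint_left.1 (hS.disjoint_of_ne (Ne.symm h) _) hi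
      (cyl_initSeg_succ_subset β _ (hx _))
  have h1 := hS.small _ hi
  have h2 := closure_minimal (hS.small _) Metric.isClosed_closedBall (hy _ hβ)
  simp only [Nat.unpair_pair, Metric.mem_closedBall] at h1 h2
  linarith [dist_triangle_right x y (s i)]

end AlmostDecidable

end

section measure

variable {X : Type*} [MetricSpace X] [MeasurableSpace X] [BorelSpace X] {s : ℕ → X}
  {μ : ProbabilityMeasure X}

theorem IsComputableProbabilitySpace.exists_almostDecidable_family
    (hX : IsComputableProbabilitySpace s μ) : ∃ S, AlmostDecidable s μ S := by
  obtain ⟨U, V, hU, hV, hd, hf, hb, hc⟩ := hX.exists_almostDecidable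
  refine ⟨fun p => {x | p.1 = true ∧ x ∈ U p.2 ∨ p.1 = false ∧ x ∈ V p.2}, ?_, ?_, ?_, ?_, ?_⟩
  · obtain ⟨R, hR, hUR⟩ := hU.exists_rel
    obtain ⟨R', hR', hVR⟩ := hV.exists_rel
    have cb : Primrec fun p : (Bool × ℕ) × ℕ => p.1.1 := Primrec.fst.comp Primrec.fst
    have c : Computable fun p : (Bool × ℕ) × ℕ => (p.1.2, p.2) :=
      Computable.pair (Computable.snd.comp Computable.fst) Computable.snd
    have hb := fun b : Bool => REPred.of_primrecPred (Primrec.eq.comp cb (Primrec.const b))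
    refine REOpen.of_rel (((hb true).and (hR.comp c)).or ((hb false).and (hR'.comp c)))
      fun p x => ?_
    obtain ⟨b, k⟩ := p
    cases b <;> simp [hUR, hVR]
  · exact fun k => by simpa using hd k
  · exact fun k => by simpa using hf k
  · exact fun k => by simpa using hb k
  · exact fun x j => by simpa using hc x j

namespace AlmostDecidable

variable {S : Bool × ℕ → Set X}

theorem measureReal_cyl_add (hS : AlmostDecidable s μ S) (w : List Bool) (c : Bool) :
    (μ : Measure X).real (cyl S (c :: w)) + (μ : Measure X).real (cyl S ((!c) :: w)) =
      (μ : Measure X).real (cyl S w) := by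
  have hd : Disjoint (cyl S (c :: w)) (cyl S ((!c) :: w)) :=
    (hS.disjoint_of_ne (Bool.not_ne_self c).symm w.length).mono
      Set.inter_subset_right Set.inter_subset_right
  rw [← measureReal_union hd (hS.isOpen_cyl _).measurableSet]
  refine measureReal_congr ?_
  have h1 : ∀ᵐ x ∂(μ : Measure X), x ∈ S (true, w.length) ∪ S (false, w.length) :=
    (mem_ae_iff_prob_eq_one ((hS.isOpen _).union (hS.isOpen _)).measurableSet).2 (hS.full _)
  filter_upwards [h1] with x hx
  refine propext ⟨?_, fun h => ?_⟩
  · rintro (h | h) <;> exact h.1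
  · cases c
    · exact hx.symm.imp (fun h' => ⟨h, h'⟩) fun h' => ⟨h, h'⟩
    · exact hx.imp (fun h' => ⟨h, h'⟩) fun h' => ⟨h, h'⟩

theorem measureReal_beside_cons_self (hS : AlmostDecidable s μ S) (c : Bool) (w : List Bool) :
    (μ : Measure X).real (beside S c (c :: w)) =
      (μ : Measure X).real (beside S c w) + (μ : Measure X).real (cyl S ((!c) :: w)) := by
  have : beside S c (c :: w) = beside S c w ∪ cyl S ((!c) :: w) := by simp [beside]
  rw [this, measureReal_union ((hS.disjoint_beside_cyl c w).mono_right (cyl_cons_subset _ _))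
    (hS.isOpen_cyl _).measurableSet]

/-- Up to a null set, the cylinders below, at and above `w` exhaust the space. This is what makes
the end points computable: `lo` is by definition approximable only from below and `hi` only from
above, and the identity supplies the opposite approximations. -/
theorem lo_add_measureReal_cyl (hS : AlmostDecidable s μ S) (w : List Bool) :
    lo μ S w + (μ : Measure X).real (cyl S w) = hi μ S w := by
  induction w with
  | nil => simp [lo, hi, beside, cyl]
  | cons b w ih =>
    have h1 := hS.measureReal_cyl_add w b
    have h2 := hS.measureReal_beside_cons_self b w
    have h3 := beside_cons_not (S := S) (!b) w
    rw [Bool.not_not] at h3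
    cases b <;> simp only [lo, hi, Bool.not_true, Bool.not_false] at * <;> rw [h2, h3] <;> linarith

theorem lo_true (hS : AlmostDecidable s μ S) (w : List Bool) :
    lo μ S (true :: w) = hi μ S (false :: w) := by
  rw [← hS.lo_add_measureReal_cyl (false :: w), lo_false, lo, hS.measureReal_beside_cons_self]
  rfl

theorem lo_le_hi (hS : AlmostDecidable s μ S) (w : List Bool) : lo μ S w ≤ hi μ S w := by
  rw [← hS.lo_add_measureReal_cyl w]
  exact le_add_of_nonneg_right measureReal_nonneg

theorem lo_le_lo_cons (hS : AlmostDecidable s μ S) (b : Bool) (w : List Bool) :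
    lo μ S w ≤ lo μ S (b :: w) := by
  cases b
  · rw [lo_false]
  · rw [hS.lo_true, ← lo_false w]
    exact hS.lo_le_hi _

theorem hi_cons_le_hi (hS : AlmostDecidable s μ S) (b : Bool) (w : List Bool) :
    hi μ S (b :: w) ≤ hi μ S w := by
  cases b
  · rw [← hS.lo_true, ← hi_true w]
    exact hS.lo_le_hi _
  · rw [hi_true]

theorem monotone_lo_initSeg (hS : AlmostDecidable s μ S) (β : ℕ → Bool) :
    Monotone fun n => lo μ S (initSeg β n) :=
  monotone_nat_of_le_succ fun _ => hS.lo_le_lo_cons _ _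

theorem antitone_hi_initSeg (hS : AlmostDecidable s μ S) (β : ℕ → Bool) :
    Antitone fun n => hi μ S (initSeg β n) :=
  antitone_nat_of_succ_le fun _ => hS.hi_cons_le_hi _ _

/-- If the beginnings differ, their intervals are already separated and contain the given ones. If
only the last letters differ, the two intervals share the end point of `lo_true`. -/
theorem hi_le_lo_or (hS : AlmostDecidable s μ S) {v w : List Bool} (hl : v.length = w.length)
    (hne : v ≠ w) : hi μ S v ≤ lo μ S w ∨ hi μ S w ≤ lo μ S v := by
  induction v generalizing w with
  | nil => exact absurd (List.length_eq_zero_iff.1 hl.symm).symm hne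
  | cons b v ih =>
    obtain _ | ⟨c, w⟩ := w
    · simp at hl
    by_cases h : v = w
    · subst h
      cases b <;> cases c
      · exact absurd rfl hne
      · exact Or.inl (hS.lo_true v).ge
      · exact Or.inr (hS.lo_true v).ge
      · exact absurd rfl hne
    · refine (ih (by simpa using hl) h).imp (fun h => ?_) fun h => ?_ <;>
      exact ((hS.hi_cons_le_hi _ _).trans h).trans (hS.lo_le_lo_cons _ _)

theorem eq_of_mem_Ioo_of_mem_Icc (hS : AlmostDecidable s μ S) {v w : List Bool}
    (hl : v.length = w.length) {y : ℝ} (hv : y ∈ Set.Ioo (lo μ S v) (hi μ S v))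
    (hw : y ∈ Set.Icc (lo μ S w) (hi μ S w)) : v = w := by
  by_contra hne
  rcases hS.hi_le_lo_or hl hne with h | h
  · linarith [hv.2, hw.1]
  · linarith [hv.1, hw.2]

/-- The absence of atoms is used here: the intersection of the cylinders has at most one point, so
it is null, and continuity from above applies. -/
theorem tendsto_measureReal_cyl (hS : AlmostDecidable s μ S)
    (hμ : ∀ x : X, (μ : Measure X) {x} = 0) (β : ℕ → Bool) :
    Filter.Tendsto (fun n => (μ : Measure X).real (cyl S (initSeg β n))) Filter.atTop (nhds 0) := by
  have h0 : (μ : Measure X) (⋂ n, cyl S (initSeg β n)) = 0 := by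
    rcases (⋂ n, cyl S (initSeg β n)).eq_empty_or_nonempty with h | ⟨x, hx⟩
    · rw [h, measure_empty]
    · refine measure_mono_null (fun y hy => ?_) (hμ x)
      rw [Set.mem_iInter] at hx hy
      refine (hS.subsingleton_iInter_cyl β hx fun k hk => subset_closure ?_).symm
      have := cyl_initSeg_succ_subset β k (hy (k + 1))
      rwa [hk] at this
  have := tendsto_measure_iInter_atTop (μ := (μ : Measure X))
    (fun n => (hS.isOpen_cyl (initSeg β n)).measurableSet.nullMeasurableSet)
    (antitone_cyl_initSeg β) ⟨0, measure_ne_top _ _⟩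
  rw [h0] at this
  exact (ENNReal.tendsto_toReal ENNReal.zero_ne_top).comp this

theorem tendsto_hi_sub_lo (hS : AlmostDecidable s μ S)
    (hμ : ∀ x : X, (μ : Measure X) {x} = 0) (β : ℕ → Bool) :
    Filter.Tendsto (fun n => hi μ S (initSeg β n) - lo μ S (initSeg β n)) Filter.atTop (nhds 0) :=
  (hS.tendsto_measureReal_cyl hμ β).congr fun n => by
    rw [← hS.lo_add_measureReal_cyl]; ring

theorem lowerSemicomputable_lo (hS : AlmostDecidable s μ S)
    (hX : IsComputableProbabilitySpace s μ) : LowerSemicomputable (lo μ S) :=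
  hX.lowerSemicomputable_measureReal (hX.metric.reOpen_beside hS.reOpen true)

theorem lowerSemicomputable_neg_hi (hS : AlmostDecidable s μ S)
    (hX : IsComputableProbabilitySpace s μ) : LowerSemicomputable fun w => -hi μ S w :=
  ((hX.lowerSemicomputable_measureReal (hX.metric.reOpen_beside hS.reOpen false)).add
    (LowerSemicomputable.const_neg_nat 1)).of_eq fun w => by rw [hi]; push_cast; ring

theorem lowerSemicomputable_hi (hS : AlmostDecidable s μ S)
    (hX : IsComputableProbabilitySpace s μ) : LowerSemicomputable (hi μ S) :=
  ((hS.lowerSemicomputable_lo hX).add (hX.lowerSemicomputable_measureReal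
    (hX.metric.reOpen_cyl hS.reOpen))).of_eq fun w => hS.lo_add_measureReal_cyl w

theorem lowerSemicomputable_neg_lo (hS : AlmostDecidable s μ S)
    (hX : IsComputableProbabilitySpace s μ) : LowerSemicomputable fun w => -lo μ S w :=
  ((hS.lowerSemicomputable_neg_hi hX).add (hX.lowerSemicomputable_measureReal
    (hX.metric.reOpen_cyl hS.reOpen))).of_eq fun w => by
      rw [← hS.lo_add_measureReal_cyl w]; ring

end AlmostDecidable

end measure

/-! ### Computable maps are continuous -/

theorem ComputableOn.continuousOn {X Y : Type*} [PseudoMetricSpace X] [PseudoMetricSpace Y]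
    {s : ℕ → X} {t : ℕ → Y} {F : X → Y} {D : Set X} (h : ComputableOn s t F D)
    (ht : DenseRange t) : ContinuousOn F D := by
  obtain ⟨U, hU, h⟩ := h
  refine Metric.continuousOn_iff'.2 fun x hx ε hε => ?_
  obtain ⟨n, hn, hn'⟩ := exists_mem_idealBall ht (F x) (half_pos hε)
  have hxU : x ∈ U n ∩ D := h n ▸ ⟨hx, hn⟩
  have hUo : IsOpen (U n) := REOpen.isOpen (α := ℕ) hU n
  filter_upwards [mem_nhdsWithin.2 ⟨U n, hUo, hxU.1, subset_rfl⟩] with y hy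
  have hy' : F y ∈ idealBall t n := ((h n).symm ▸ hy : y ∈ D ∩ F ⁻¹' idealBall t n).2
  rw [idealBall, Metric.mem_ball] at hn hy'
  linarith [dist_triangle_right (F y) (F x) (t n.unpair.1)]

/-- Nothing is known of `F` off `D`, so the preimage is formed in the subtype and mapped back. -/
theorem measurableSet_inter_preimage_of_continuousOn {X Y : Type*} [TopologicalSpace X]
    [MeasurableSpace X] [OpensMeasurableSpace X] [TopologicalSpace Y] [MeasurableSpace Y]
    [BorelSpace Y] {F : X → Y} {D : Set X} (hF : ContinuousOn F D) (hD : MeasurableSet D)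
    {A : Set Y} (hA : MeasurableSet A) : MeasurableSet (D ∩ F ⁻¹' A) := by
  have h : Measurable (D.domRestrict F) := hF.domRestrict.measurable
  have := hD.subtype_image (h hA)
  rwa [Set.domRestrict_eq, Set.preimage_comp, Subtype.image_preimage_coe] at this

theorem IsConstructiveGδ.measurableSet {X : Type*} [PseudoMetricSpace X] [MeasurableSpace X]
    [OpensMeasurableSpace X] {s : ℕ → X} {D : Set X} (hD : IsConstructiveGδ s D) :
    MeasurableSet D := by
  obtain ⟨U, hU, rfl⟩ := hD
  exact MeasurableSet.iInter fun i => (REOpen.isOpen (α := ℕ) hU i).measurableSet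

/-! ### The map to the unit interval -/

/-- The points that have an itinerary. -/
def core {X : Type*} (S : Bool × ℕ → Set X) : Set X := ⋂ k, S (true, k) ∪ S (false, k)

open Classical in
/-- The itinerary of a point. -/
noncomputable def itinerary {X : Type*} (S : Bool × ℕ → Set X) (x : X) (k : ℕ) : Bool :=
  decide (x ∈ S (true, k))

open Classical in
theorem mem_itinerary {X : Type*} {S : Bool × ℕ → Set X} {x : X} (hx : x ∈ core S)
    (k : ℕ) : x ∈ S (itinerary S x k, k) := by
  by_cases h : x ∈ S (true, k)
  · rwa [itinerary, decide_eq_true h]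
  · rw [itinerary, decide_eq_false h]
    exact (Set.mem_iInter.1 hx k).resolve_left h

/-- The point of the unit interval that corresponds to `x`. -/
noncomputable def toUnit {X : Type*} [MeasurableSpace X] (μ : ProbabilityMeasure X)
    (S : Bool × ℕ → Set X) (x : X) : unitInterval :=
  ⟨⨆ n, lo μ S (initSeg (itinerary S x) n),
    Real.iSup_nonneg fun _ => lo_nonneg _,
    Real.iSup_le (fun _ => measureReal_le_one) zero_le_one⟩

namespace AlmostDecidable

section

variable {X : Type*} [MetricSpace X] [MeasurableSpace X] {s : ℕ → X} {μ : ProbabilityMeasure X}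
  {S : Bool × ℕ → Set X}

open Classical in
theorem itinerary_eq (hS : AlmostDecidable s μ S) {x : X} {b : Bool} {k : ℕ}
    (hx : x ∈ S (b, k)) : itinerary S x k = b := by
  cases b
  · exact decide_eq_false fun h => Set.disjoint_left.1 (hS.disjoint k) h hx
  · exact decide_eq_true hx

theorem eq_initSeg_itinerary (hS : AlmostDecidable s μ S) {x : X} {w : List Bool}
    (hx : x ∈ cyl S w) : w = initSeg (itinerary S x) w.length := by
  induction w with
  | nil => rfl
  | cons b w ih => rw [List.length_cons, initSeg, ← ih hx.1, hS.itinerary_eq hx.2]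

theorem isConstructiveGδ_core (hS : AlmostDecidable s μ S) : IsConstructiveGδ s (core S) :=
  ⟨fun k => S (true, k) ∪ S (false, k),
    (hS.reOpen.comp (Computable.pair (Computable.const true) Computable.id)).union
      (hS.reOpen.comp (Computable.pair (Computable.const false) Computable.id)), rfl⟩

end

variable {X : Type*} [MetricSpace X] [MeasurableSpace X] [BorelSpace X] {s : ℕ → X}
  {μ : ProbabilityMeasure X} {S : Bool × ℕ → Set X}

theorem ae_mem_core (hS : AlmostDecidable s μ S) : ∀ᵐ x ∂(μ : Measure X), x ∈ core S := by
  simp only [core, Set.mem_iInter]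
  exact ae_all_iff.2 fun k =>
    (mem_ae_iff_prob_eq_one ((hS.isOpen _).union (hS.isOpen _)).measurableSet).2 (hS.full _)

theorem measure_core (hS : AlmostDecidable s μ S) : (μ : Measure X) (core S) = 1 :=
  (mem_ae_iff_prob_eq_one hS.isConstructiveGδ_core.measurableSet).1 hS.ae_mem_core

/-- The intervals along an itinerary are nested, so each lower end is below every upper end.
Membership in `core` is not needed, as `itinerary` is defined everywhere. -/
theorem toUnit_mem_Icc (hS : AlmostDecidable s μ S) (x : X) (n : ℕ) : (toUnit μ S x : ℝ) ∈
    Set.Icc (lo μ S (initSeg (itinerary S x) n)) (hi μ S (initSeg (itinerary S x) n)) := by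
  constructor
  · exact le_ciSup (f := fun n => lo μ S (initSeg (itinerary S x) n))
      ⟨1, Set.forall_mem_range.2 fun _ => measureReal_le_one⟩ n
  · refine ciSup_le fun m => ?_
    exact ((hS.monotone_lo_initSeg _ (le_max_left m n)).trans (hS.lo_le_hi _)).trans
      (hS.antitone_hi_initSeg _ (le_max_right m n))

theorem toUnit_mem_Icc_of_mem_cyl (hS : AlmostDecidable s μ S) {x : X} {w : List Bool}
    (hx : x ∈ cyl S w) : (toUnit μ S x : ℝ) ∈ Set.Icc (lo μ S w) (hi μ S w) := by
  have := hS.toUnit_mem_Icc x w.length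
  rwa [← hS.eq_initSeg_itinerary hx] at this

/-- This is monotonicity for the lexicographic order: at the branching, the upper end of the left
half is the lower end of the right half. -/
theorem toUnit_le_of_mem_beside (hS : AlmostDecidable s μ S) {x : X} {w : List Bool}
    (hx : x ∈ beside S true w) : (toUnit μ S x : ℝ) ≤ lo μ S w := by
  induction w with
  | nil => exact hx.elim
  | cons b w ih =>
    rcases hx with hx | ⟨rfl, hx⟩
    · exact (ih hx).trans (hS.lo_le_lo_cons _ _)
    · rw [hS.lo_true]
      exact (hS.toUnit_mem_Icc_of_mem_cyl hx).2

theorem le_toUnit_of_mem_beside (hS : AlmostDecidable s μ S) {x : X} {w : List Bool}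
    (hx : x ∈ beside S false w) : hi μ S w ≤ (toUnit μ S x : ℝ) := by
  induction w with
  | nil => exact hx.elim
  | cons b w ih =>
    rcases hx with hx | ⟨rfl, hx⟩
    · exact (hS.hi_cons_le_hi _ _).trans (ih hx)
    · rw [← hS.lo_true]
      exact (hS.toUnit_mem_Icc_of_mem_cyl hx).1

/-- On `core`, the preimage of a ball is the union of the cylinders whose closed intervals lie
inside the ball. Such a cylinder exists around every point of the preimage because the lengths tend
to zero. -/
theorem computableOn_toUnit (hS : AlmostDecidable s μ S) (hX : IsComputableProbabilitySpace s μ)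
    (hμ : ∀ x : X, (μ : Measure X) {x} = 0) :
    ComputableOn s unitIdeal (toUnit μ S) (core S) := by
  have cw : Computable fun p : ℕ × List Bool => p.2 := Computable.snd
  have cc : Computable fun p : ℕ × List Bool => p.1.unpair.1 :=
    Computable.fst.comp (Computable.unpair.comp Computable.fst)
  have cq : Computable fun p : ℕ × List Bool => p.1.unpair.2 :=
    Computable.snd.comp (Computable.unpair.comp Computable.fst)
  have cn : Computable fun p : ℕ × List Bool => unitNum p.1.unpair.1 :=
    primrec_unitNum.to_comp.comp cc
  have cd : Computable fun p : ℕ × List Bool => p.1.unpair.1.unpair.2 :=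
    Computable.snd.comp (Computable.unpair.comp cc)
  have q1 := LowerSemicomputable.neg_natCast_div cn cd
  have q2 := LowerSemicomputable.natCast_div cn cd
  have q3 := LowerSemicomputable.posRatOf.comp cq
  have r1 := ((q1.add q3).add ((hS.lowerSemicomputable_lo hX).comp cw)).pos
  have r2 := ((q2.add q3).add ((hS.lowerSemicomputable_neg_hi hX).comp cw)).pos
  refine ⟨_, ((hX.metric.reOpen_cyl hS.reOpen).comp cw).exists_and (r1.and r2), fun m => ?_⟩
  ext x
  simp only [← coe_unitIdeal]
  simp only [Set.mem_inter_iff, Set.mem_preimage, idealBall, Metric.mem_ball, Subtype.dist_eq,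
    Real.dist_eq, abs_lt, Set.mem_ofPred_eq]
  constructor
  · rintro ⟨hx, h1, h2⟩
    refine ⟨?_, hx⟩
    obtain ⟨ε, hε, hε1, hε2⟩ : ∃ ε : ℝ, 0 < ε ∧
        ε ≤ posRatOf m.unpair.2 - (toUnit μ S x - unitIdeal m.unpair.1) ∧
        ε ≤ posRatOf m.unpair.2 + (toUnit μ S x - unitIdeal m.unpair.1) :=
      ⟨min _ _, lt_min (by linarith) (by linarith), min_le_left _ _, min_le_right _ _⟩
    obtain ⟨n, hn⟩ := ((hS.tendsto_hi_sub_lo hμ (itinerary S x)).eventually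
      (gt_mem_nhds hε)).exists
    have := hS.toUnit_mem_Icc x n
    refine ⟨initSeg (itinerary S x) n, ⟨?_, ?_⟩, mem_cyl_initSeg (mem_itinerary hx) n⟩
    · linarith [this.1, this.2]
    · linarith [this.1, this.2]
  · rintro ⟨⟨w, ⟨h1, h2⟩, hw⟩, hx⟩
    have := hS.toUnit_mem_Icc_of_mem_cyl hw
    exact ⟨hx, by linarith [this.1], by linarith [this.2]⟩

end AlmostDecidable

/-! ### The itinerary of a real number -/

/-- The word of length `n` whose interval contains `y`. -/
noncomputable def realWord {X : Type*} [MeasurableSpace X] (μ : ProbabilityMeasure X)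
    (S : Bool × ℕ → Set X) (y : ℝ) : ℕ → List Bool
  | 0 => []
  | n + 1 => decide (hi μ S (false :: realWord μ S y n) ≤ y) :: realWord μ S y n

/-- The sequence of the letters of the words whose intervals contain `y`. -/
noncomputable def realItinerary {X : Type*} [MeasurableSpace X] (μ : ProbabilityMeasure X)
    (S : Bool × ℕ → Set X) (y : ℝ) (n : ℕ) : Bool :=
  decide (hi μ S (false :: realWord μ S y n) ≤ y)

theorem initSeg_realItinerary {X : Type*} [MeasurableSpace X] (μ : ProbabilityMeasure X)
    (S : Bool × ℕ → Set X) (y : ℝ) (n : ℕ) : initSeg (realItinerary μ S y) n = realWord μ S y n := by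
  induction n with
  | zero => rfl
  | succ n ih => rw [initSeg, ih, realWord, realItinerary]

namespace AlmostDecidable

variable {X : Type*} [MetricSpace X] [MeasurableSpace X] [BorelSpace X] {s : ℕ → X}
  {μ : ProbabilityMeasure X} {S : Bool × ℕ → Set X}

/-- Each step bisects the interval at `hi (false :: w) = lo (true :: w)`; the dividing point itself
goes to `true`. -/
theorem mem_Icc_realItinerary (hS : AlmostDecidable s μ S) {y : ℝ} (hy : y ∈ Set.Icc (0 : ℝ) 1)
    (n : ℕ) : y ∈ Set.Icc (lo μ S (initSeg (realItinerary μ S y) n))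
      (hi μ S (initSeg (realItinerary μ S y) n)) := by
  rw [initSeg_realItinerary]
  induction n with
  | zero => simpa [realWord, lo, hi, beside] using hy
  | succ n ih =>
    rw [realWord]
    by_cases h : hi μ S (false :: realWord μ S y n) ≤ y
    · rw [decide_eq_true h]
      exact ⟨(hS.lo_true _).trans_le h, ih.2.trans_eq (hi_true _).symm⟩
    · rw [decide_eq_false h]
      exact ⟨(lo_false _).trans_le ih.1, (not_le.1 h).le⟩

theorem eq_initSeg_realItinerary (hS : AlmostDecidable s μ S) {y : ℝ} {w : List Bool}
    (hy : y ∈ Set.Ioo (lo μ S w) (hi μ S w)) : w = initSeg (realItinerary μ S y) w.length :=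
  hS.eq_of_mem_Ioo_of_mem_Icc (length_initSeg _ _).symm hy (hS.mem_Icc_realItinerary
    ⟨(lo_nonneg w).trans hy.1.le, hy.2.le.trans (hi_le_one w)⟩ _)

/-- The image measure has distribution function `t`. Given a short interval of a word around `t`,
the points beside its cylinder on the left are sent below `t` and have mass `lo`, while those on the
right are not sent below `t` and have mass `1 - hi`. -/
theorem map_toUnit (hS : AlmostDecidable s μ S) (hX : IsComputableProbabilitySpace s μ)
    (hμ : ∀ x : X, (μ : Measure X) {x} = 0) {A : Set unitInterval} (hA : MeasurableSet A) :
    (μ : Measure X) (core S ∩ toUnit μ S ⁻¹' A) = volume A := by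
  have hD := hS.isConstructiveGδ_core.measurableSet
  have hF := (hS.computableOn_toUnit hX hμ).continuousOn denseRange_unitIdeal
  have hFm := hF.aemeasurable (μ := (μ : Measure X)) hD
  let π : Measure unitInterval := ((μ : Measure X).restrict (core S)).map (toUnit μ S)
  have hπ : ∀ A : Set unitInterval, MeasurableSet A →
      π A = (μ : Measure X) (core S ∩ toUnit μ S ⁻¹' A) := fun A hA => by
    rw [Measure.map_apply_of_aemeasurable hFm hA, Measure.restrict_apply₀' hD.nullMeasurableSet,
      Set.inter_comm]
  have : IsProbabilityMeasure π := ⟨by rw [hπ _ MeasurableSet.univ]; simpa using hS.measure_core⟩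
  have hpi : ∀ {A : Set unitInterval}, MeasurableSet A →
      π.real A = (μ : Measure X).real (core S ∩ toUnit μ S ⁻¹' A) := fun {A} hA => by
    rw [measureReal_def, hπ A hA, measureReal_def]
  have hmesh : ∀ (t : unitInterval) (ε : ℝ), 0 < ε → ∃ w, (t : ℝ) ∈ Set.Icc (lo μ S w) (hi μ S w) ∧
      hi μ S w - lo μ S w < ε := fun t ε hε => by
    obtain ⟨n, hn⟩ := ((hS.tendsto_hi_sub_lo hμ (realItinerary μ S t)).eventually
      (gt_mem_nhds hε)).exists
    exact ⟨_, hS.mem_Icc_realItinerary t.2 n, hn⟩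
  have hlow : ∀ t : unitInterval, (t : ℝ) ≤ π.real (Set.Iic t) := fun t => by
    refine le_of_forall_pos_le_add fun ε hε => ?_
    obtain ⟨w, hw, hwε⟩ := hmesh t ε hε
    have h1 : lo μ S w ≤ π.real (Set.Iic t) := by
      rw [hpi measurableSet_Iic, lo]
      have h2 : (μ : Measure X).real (beside S true w) =
          (μ : Measure X).real (core S ∩ beside S true w) :=
        measureReal_congr (by
          filter_upwards [hS.ae_mem_core] with x hx
          exact propext ⟨fun h => ⟨hx, h⟩, fun h => h.2⟩)
      rw [h2]
      refine measureReal_mono fun x hx => ⟨hx.1, ?_⟩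
      exact Subtype.coe_le_coe.1 ((hS.toUnit_le_of_mem_beside hx.2).trans hw.1)
    linarith [hw.2]
  -- Points beside the cylinder on the right may be sent to `t` itself if `t` is an end point, hence
  -- the open ray; `hup'` recovers the closed one by letting `r` decrease to `t`.
  have hup : ∀ t : unitInterval, π.real (Set.Iio t) ≤ (t : ℝ) := fun t => by
    refine le_of_forall_pos_le_add fun ε hε => ?_
    obtain ⟨w, hw, hwε⟩ := hmesh t ε hε
    have h1 : π.real (Set.Iio t) ≤ hi μ S w := by
      rw [hpi measurableSet_Iio, hi, ← probReal_compl_eq_one_sub (hS.isOpen_beside _ _).measurableSet]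
      refine measureReal_mono fun x hx hx' => ?_
      have h3 : (toUnit μ S x : ℝ) < t := hx.2
      linarith [hS.le_toUnit_of_mem_beside hx', hw.2]
    linarith [hw.1]
  have hup' : ∀ t : unitInterval, π.real (Set.Iic t) ≤ (t : ℝ) := fun t => by
    refine le_of_forall_gt_imp_ge_of_dense fun r hr => ?_
    by_cases hr1 : r ≤ 1
    · refine le_trans (measureReal_mono fun y hy => ?_) (hup ⟨r, t.2.1.trans hr.le, hr1⟩)
      have hyt : (y : ℝ) ≤ t := hy
      exact hyt.trans_lt hr
    · exact measureReal_le_one.trans (not_le.1 hr1).le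
  have hvol : π = volume := by
    refine Measure.ext_of_Iic _ _ fun t => ?_
    rw [unitInterval.volume_Iic, ← ofReal_measureReal (measure_ne_top _ _),
      le_antisymm (hup' t) (hlow t)]
  rw [← hπ A hA, hvol]

end AlmostDecidable

/-! ### The map from the unit interval -/

/-- The real numbers in the interior of the intervals of words that end with the letter `true`, at
positions `⟨i, j⟩` for every `j`. -/
def unitCore {X : Type*} [MeasurableSpace X] (μ : ProbabilityMeasure X) (S : Bool × ℕ → Set X) :
    Set unitInterval :=
  ⋂ j, {y | ∃ w : List Bool, w.length.unpair.2 = j ∧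
    (y : ℝ) ∈ Set.Ioo (lo μ S (true :: w)) (hi μ S (true :: w))}

open Classical in
/-- The point of `X` that corresponds to `y`; `x₀` where there is none. -/
noncomputable def ofUnit {X : Type*} [TopologicalSpace X] [MeasurableSpace X]
    (μ : ProbabilityMeasure X) (S : Bool × ℕ → Set X) (x₀ : X) (y : unitInterval) : X :=
  if h : ∃ x, ∀ n, x ∈ closure (cyl S (initSeg (realItinerary μ S y) n)) then h.choose else x₀

namespace AlmostDecidable

variable {X : Type*} [MetricSpace X] [MeasurableSpace X] [BorelSpace X] {s : ℕ → X}
  {μ : ProbabilityMeasure X} {S : Bool × ℕ → Set X}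

theorem reOpen_Ioo (hS : AlmostDecidable s μ S) (hX : IsComputableProbabilitySpace s μ) :
    REOpen unitIdeal fun w => {y : unitInterval | (y : ℝ) ∈ Set.Ioo (lo μ S w) (hi μ S w)} := by
  have cw : Computable fun p : List Bool × ℕ => p.1 := Computable.fst
  have cc : Computable fun p : List Bool × ℕ => p.2.unpair.1 :=
    Computable.fst.comp (Computable.unpair.comp Computable.snd)
  have cq : Computable fun p : List Bool × ℕ => p.2.unpair.2 :=
    Computable.snd.comp (Computable.unpair.comp Computable.snd)
  have cn : Computable fun p : List Bool × ℕ => unitNum p.2.unpair.1 :=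
    primrec_unitNum.to_comp.comp cc
  have cd : Computable fun p : List Bool × ℕ => p.2.unpair.1.unpair.2 :=
    Computable.snd.comp (Computable.unpair.comp cc)
  have q1 := LowerSemicomputable.neg_natCast_div cn cd
  have q2 := LowerSemicomputable.natCast_div cn cd
  have q3 := LowerSemicomputable.neg_posRatOf.comp cq
  have r1 := ((q2.add q3).add ((hS.lowerSemicomputable_neg_lo hX).comp cw)).pos
  have r2 := ((q1.add q3).add ((hS.lowerSemicomputable_hi hX).comp cw)).pos
  refine REOpen.of_rel (r1.and r2) fun w y => ?_
  simp only [← coe_unitIdeal]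
  simp only [idealBall, Metric.mem_ball, Subtype.dist_eq, Real.dist_eq, abs_lt, Set.mem_Ioo,
    Set.mem_ofPred_eq]
  constructor
  · rintro ⟨h1, h2⟩
    obtain ⟨ε, hε, hε1, hε2⟩ : ∃ ε : ℝ, 0 < ε ∧ ε ≤ y - lo μ S w ∧ ε ≤ hi μ S w - y :=
      ⟨min _ _, lt_min (sub_pos.2 h1) (sub_pos.2 h2), min_le_left _ _, min_le_right _ _⟩
    obtain ⟨n, hn, hn'⟩ := exists_mem_idealBall denseRange_unitIdeal y (half_pos hε)
    rw [idealBall, Metric.mem_ball, Subtype.dist_eq, Real.dist_eq, abs_lt] at hn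
    exact ⟨n, ⟨by linarith [hn.1, hn.2], by linarith [hn.1, hn.2]⟩, hn⟩
  · rintro ⟨n, ⟨h1, h2⟩, h3, h4⟩
    constructor <;> linarith

theorem isConstructiveGδ_unitCore (hS : AlmostDecidable s μ S)
    (hX : IsComputableProbabilitySpace s μ) : IsConstructiveGδ unitIdeal (unitCore μ S) := by
  have c : Computable fun p : ℕ × List Bool => true :: p.2 :=
    (Primrec.list_cons.comp (Primrec.const true) Primrec.snd).to_comp
  have hp : PrimrecPred fun p : ℕ × List Bool => p.2.length.unpair.2 = p.1 :=
    Primrec.eq.comp (Primrec.snd.comp (Primrec.unpair.comp (Primrec.list_length.comp Primrec.snd)))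
      Primrec.fst
  exact ⟨_, ((hS.reOpen_Ioo hX).comp c).exists_and (REPred.of_primrecPred hp), rfl⟩

theorem mem_Ioo_of_mem_unitCore (hS : AlmostDecidable s μ S) {y : unitInterval}
    (hy : y ∈ unitCore μ S) (n : ℕ) : (y : ℝ) ∈ Set.Ioo
      (lo μ S (initSeg (realItinerary μ S y) n)) (hi μ S (initSeg (realItinerary μ S y) n)) := by
  obtain ⟨w, hw, hyw⟩ := Set.mem_iInter.1 hy n
  -- The second component of a pair is at most its code, so the conditions for all `j` also provide
  -- arbitrarily long words.
  have hn : n ≤ (true :: w).length := by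
    rw [List.length_cons, ← hw]
    exact (Nat.unpair_right_le _).trans (Nat.le_succ _)
  rw [hS.eq_initSeg_realItinerary hyw] at hyw
  exact ⟨(hS.monotone_lo_initSeg _ hn).trans_lt hyw.1, hyw.2.trans_le (hS.antitone_hi_initSeg _ hn)⟩

theorem exists_realItinerary_eq_true (hS : AlmostDecidable s μ S) {y : unitInterval}
    (hy : y ∈ unitCore μ S) (j : ℕ) : ∃ w : List Bool, w.length.unpair.2 = j ∧
      (y : ℝ) ∈ Set.Ioo (lo μ S (true :: w)) (hi μ S (true :: w)) ∧
      realItinerary μ S y w.length = true ∧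
      true :: w = initSeg (realItinerary μ S y) (w.length + 1) := by
  obtain ⟨w, hw, hyw⟩ := Set.mem_iInter.1 hy j
  have h := hS.eq_initSeg_realItinerary hyw
  rw [List.length_cons] at h
  refine ⟨w, hw, hyw, ?_, h⟩
  rw [initSeg] at h
  exact (List.cons_eq_cons.1 h).1.symm

/-- The cylinders have positive measure, hence contain points. The letters `true` at every scale
confine these points to ever smaller balls, so they converge. -/
theorem exists_mem_closure_cyl [CompleteSpace X] (hS : AlmostDecidable s μ S) {y : unitInterval}
    (hy : y ∈ unitCore μ S) :
    ∃ x, ∀ n, x ∈ closure (cyl S (initSeg (realItinerary μ S y) n)) := by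
  have hne : ∀ n, (cyl S (initSeg (realItinerary μ S y) n)).Nonempty := fun n => by
    by_contra h
    rw [Set.not_nonempty_iff_eq_empty] at h
    have h1 := hS.lo_add_measureReal_cyl (initSeg (realItinerary μ S y) n)
    rw [h, measureReal_empty, add_zero] at h1
    have h2 := hS.mem_Ioo_of_mem_unitCore hy n
    linarith [h2.1, h2.2]
  choose z hz using hne
  have hcauchy : CauchySeq z := by
    refine Metric.cauchySeq_iff'.2 fun ε hε => ?_
    obtain ⟨j, hj⟩ := exists_nat_one_div_lt (half_pos hε)
    obtain ⟨w, hw, -, hw1, -⟩ := hS.exists_realItinerary_eq_true hy j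
    have h : ∀ n ≥ w.length + 1, dist (z n) (s w.length.unpair.1) ≤ 1 / ((j : ℝ) + 1) := fun n hn => by
      have := cyl_initSeg_succ_subset _ _ (antitone_cyl_initSeg _ hn (hz n))
      rw [hw1] at this
      simpa [hw] using hS.small _ this
    refine ⟨w.length + 1, fun n hn => ?_⟩
    linarith [dist_triangle_right (z n) (z (w.length + 1)) (s w.length.unpair.1), h n hn,
      h _ le_rfl]
  obtain ⟨x, hx⟩ := cauchySeq_tendsto_of_complete hcauchy
  refine ⟨x, fun n => mem_closure_of_tendsto hx ?_⟩
  filter_upwards [Filter.eventually_ge_atTop n] with m hm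
  exact antitone_cyl_initSeg _ hm (hz m)

theorem ofUnit_mem_closure_cyl [CompleteSpace X] (hS : AlmostDecidable s μ S) (x₀ : X)
    {y : unitInterval} (hy : y ∈ unitCore μ S) (n : ℕ) :
    ofUnit μ S x₀ y ∈ closure (cyl S (initSeg (realItinerary μ S y) n)) := by
  have h := hS.exists_mem_closure_cyl hy
  rw [ofUnit, dif_pos h]
  exact h.choose_spec n

theorem ofUnit_mem_closure [CompleteSpace X] (hS : AlmostDecidable s μ S) (x₀ : X)
    {y : unitInterval} (hy : y ∈ unitCore μ S) (k : ℕ) :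
    ofUnit μ S x₀ y ∈ closure (S (realItinerary μ S y k, k)) :=
  closure_mono (cyl_initSeg_succ_subset _ _) (hS.ofUnit_mem_closure_cyl x₀ hy (k + 1))

/-- A last letter `true` at position `⟨i, j⟩` puts the value in the closed ball of radius `1 / (j +
1)` around `s i`. The preimage of a ball is therefore given by the open intervals of those words
whose small ball is formally inside. -/
theorem computableOn_ofUnit (hS : AlmostDecidable s μ S) (hX : IsComputableProbabilitySpace s μ)
    (x₀ : X) : ComputableOn unitIdeal s (ofUnit μ S x₀) (unitCore μ S) := by
  have := hX.metric.complete
  have c : Computable fun p : ℕ × List Bool => true :: p.2 :=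
    (Primrec.list_cons.comp (Primrec.const true) Primrec.snd).to_comp
  have cl : Computable fun p : ℕ × List Bool => p.2.length.unpair :=
    Computable.unpair.comp (Computable.list_length.comp Computable.snd)
  have cm : Computable fun p : ℕ × List Bool => p.1.unpair := Computable.unpair.comp Computable.fst
  have q1 := hX.metric.lowerSemicomputable_neg_dist.comp
    (Computable.pair (Computable.fst.comp cl) (Computable.fst.comp cm))
  have q2 := LowerSemicomputable.neg_natCast_div (Computable.const 1) (Computable.snd.comp cl)
  have q3 := LowerSemicomputable.posRatOf.comp (Computable.snd.comp cm)
  have hp := ((q1.add q2).add q3).pos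
  refine ⟨_, ((hS.reOpen_Ioo hX).comp c).exists_and hp, fun m => ?_⟩
  have key : ∀ {y : unitInterval}, y ∈ unitCore μ S → ∀ w : List Bool,
      realItinerary μ S y w.length = true →
      dist (ofUnit μ S x₀ y) (s w.length.unpair.1) ≤ 1 / ((w.length.unpair.2 : ℝ) + 1) :=
    fun {y} hy w hw => by
      have h := hS.ofUnit_mem_closure x₀ hy w.length
      rw [hw] at h
      exact closure_minimal (hS.small _) Metric.isClosed_closedBall h
  ext y
  simp only [Set.mem_inter_iff, Set.mem_preimage, idealBall, Metric.mem_ball, Set.mem_ofPred_eq,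
    Nat.cast_one]
  constructor
  · rintro ⟨hy, h⟩
    refine ⟨?_, hy⟩
    obtain ⟨j, hj⟩ := exists_nat_one_div_lt (half_pos (sub_pos.2 h))
    obtain ⟨w, hw, hyw, hw1, -⟩ := hS.exists_realItinerary_eq_true hy j
    have h1 := key hy w hw1
    refine ⟨w, ?_, hyw⟩
    rw [hw] at h1 ⊢
    linarith [dist_triangle_left (s w.length.unpair.1) (s m.unpair.1) (ofUnit μ S x₀ y)]
  · rintro ⟨⟨w, hw, hyw⟩, hy⟩
    refine ⟨hy, ?_⟩
    have h := hS.eq_initSeg_realItinerary hyw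
    rw [List.length_cons, initSeg] at h
    have h1 := key hy w (List.cons_eq_cons.1 h).1.symm
    linarith [dist_triangle (ofUnit μ S x₀ y) (s w.length.unpair.1) (s m.unpair.1)]

theorem ofUnit_toUnit [CompleteSpace X] (hS : AlmostDecidable s μ S) (x₀ : X) {x : X}
    (hx : x ∈ core S) (hy : toUnit μ S x ∈ unitCore μ S) : ofUnit μ S x₀ (toUnit μ S x) = x := by
  refine (hS.subsingleton_iInter_cyl (itinerary S x) (mem_cyl_initSeg (mem_itinerary hx))
    fun k hk => ?_).symm
  -- The image is interior to the intervals of its real itinerary and belongs to those of the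
  -- itinerary of `x`, so the two agree.
  have h1 := hS.eq_of_mem_Ioo_of_mem_Icc (by simp) (hS.mem_Ioo_of_mem_unitCore hy (k + 1))
    (hS.toUnit_mem_Icc x (k + 1))
  rw [initSeg, initSeg] at h1
  have h2 := hS.ofUnit_mem_closure x₀ hy k
  rwa [(List.cons_eq_cons.1 h1).1, hk] at h2

/-- An open set that meets the closure of another meets that set itself. Hence a point of `core` in
the closures along a sequence has that sequence as its itinerary. -/
theorem toUnit_ofUnit [CompleteSpace X] (hS : AlmostDecidable s μ S)
    (hμ : ∀ x : X, (μ : Measure X) {x} = 0) (x₀ : X) {y : unitInterval} (hy : y ∈ unitCore μ S)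
    (hx : ofUnit μ S x₀ y ∈ core S) : toUnit μ S (ofUnit μ S x₀ y) = y := by
  have h1 : itinerary S (ofUnit μ S x₀ y) = realItinerary μ S y := by
    funext k
    by_contra hne
    have h2 := mem_itinerary hx k
    obtain ⟨z, hz1, hz2⟩ := mem_closure_iff.1 (hS.ofUnit_mem_closure x₀ hy k) _ (hS.isOpen _) h2
    exact Set.disjoint_left.1 (hS.disjoint_of_ne hne k) hz1 hz2
  have h2 : ∀ n, |(toUnit μ S (ofUnit μ S x₀ y) : ℝ) - y| ≤
      hi μ S (initSeg (realItinerary μ S y) n) - lo μ S (initSeg (realItinerary μ S y) n) :=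
    fun n => by
      have h3 := hS.toUnit_mem_Icc (ofUnit μ S x₀ y) n
      rw [h1] at h3
      have h4 := hS.mem_Ioo_of_mem_unitCore hy n
      rw [abs_le]
      constructor <;> linarith [h3.1, h3.2, h4.1, h4.2]
  have h3 := ge_of_tendsto' (hS.tendsto_hi_sub_lo hμ _) h2
  exact Subtype.ext (sub_eq_zero.1 (abs_nonpos_iff.1 h3))

/-- There are only countably many end points, so by `map_toUnit` almost no point is sent to one. All
others in `core` qualify, because `cover` provides a letter `true` at every scale. -/
theorem measure_core_inter_preimage_unitCore (hS : AlmostDecidable s μ S)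
    (hX : IsComputableProbabilitySpace s μ) (hμ : ∀ x : X, (μ : Measure X) {x} = 0) :
    (μ : Measure X) (core S ∩ toUnit μ S ⁻¹' unitCore μ S) = 1 := by
  let E : Set unitInterval :=
    (fun y : unitInterval => (y : ℝ)) ⁻¹' (Set.range (lo μ S) ∪ Set.range (hi μ S))
  have hE : E.Countable := ((Set.countable_range _).union (Set.countable_range _)).preimage
    Subtype.val_injective
  refine le_antisymm prob_le_one ?_
  have h1 : (μ : Measure X) (core S ∩ toUnit μ S ⁻¹' Eᶜ) = 1 := by
    rw [hS.map_toUnit hX hμ hE.measurableSet.compl, prob_compl_eq_one_sub hE.measurableSet,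
      hE.measure_zero, tsub_zero]
  rw [← h1]
  refine measure_mono fun x hx => ⟨hx.1, Set.mem_iInter.2 fun j => ?_⟩
  obtain ⟨i, hi⟩ := hS.cover x j
  refine ⟨initSeg (itinerary S x) (Nat.pair i j), by simp, ?_⟩
  have h2 := hS.toUnit_mem_Icc x (Nat.pair i j + 1)
  rw [initSeg, hS.itinerary_eq hi] at h2
  refine ⟨lt_of_le_of_ne h2.1 fun h => hx.2 (Or.inl ⟨_, h⟩),
    lt_of_le_of_ne h2.2 fun h => hx.2 (Or.inr ⟨_, h.symm⟩)⟩

theorem volume_unitCore (hS : AlmostDecidable s μ S)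
    (hX : IsComputableProbabilitySpace s μ) (hμ : ∀ x : X, (μ : Measure X) {x} = 0) :
    volume (unitCore μ S) = 1 := by
  rw [← hS.map_toUnit hX hμ (hS.isConstructiveGδ_unitCore hX).measurableSet,
    hS.measure_core_inter_preimage_unitCore hX hμ]

/-- Pulling back along the measure-preserving `toUnit` turns the claim into one about `ofUnit` after
`toUnit`, which is the identity almost everywhere. -/
theorem map_ofUnit (hS : AlmostDecidable s μ S) (hX : IsComputableProbabilitySpace s μ)
    (hμ : ∀ x : X, (μ : Measure X) {x} = 0) (x₀ : X) {A : Set X} (hA : MeasurableSet A) :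
    volume (unitCore μ S ∩ ofUnit μ S x₀ ⁻¹' A) = (μ : Measure X) A := by
  have := hX.metric.complete
  have hD := (hS.isConstructiveGδ_unitCore hX).measurableSet
  have hG := (hS.computableOn_ofUnit hX x₀).continuousOn hX.metric.dense
  rw [← hS.map_toUnit hX hμ (measurableSet_inter_preimage_of_continuousOn hG hD hA)]
  have hF := (hS.computableOn_toUnit hX hμ).continuousOn denseRange_unitIdeal
  have hfull : ∀ᵐ x ∂(μ : Measure X), x ∈ core S ∩ toUnit μ S ⁻¹' unitCore μ S :=
    (mem_ae_iff_prob_eq_one (measurableSet_inter_preimage_of_continuousOn hF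
      hS.isConstructiveGδ_core.measurableSet hD)).2
      (hS.measure_core_inter_preimage_unitCore hX hμ)
  refine measure_congr ?_
  filter_upwards [hfull] with x hx
  have h := hS.ofUnit_toUnit x₀ hx.1 hx.2
  refine propext ⟨fun h' => ?_, fun h' => ⟨hx.1, hx.2, ?_⟩⟩
  · have : ofUnit μ S x₀ (toUnit μ S x) ∈ A := h'.2.2
    rwa [h] at this
  · change ofUnit μ S x₀ (toUnit μ S x) ∈ A
    rwa [h]

end AlmostDecidable

end CompProb

/-! ### The isomorphism. -/

theorem mainTheorem2 {X : Type*} [MetricSpace X] [MeasurableSpace X] [BorelSpace X]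
    (s : ℕ → X) (μ : MeasureTheory.ProbabilityMeasure X)
    (hX : CompProb.IsComputableProbabilitySpace s μ)
    (hμ : ∀ x : X, (μ : MeasureTheory.Measure X) {x} = 0) :
    CompProb.IsComputableLebesgueSpace s μ := by
  obtain ⟨S, hS⟩ := hX.exists_almostDecidable_family
  have := hX.metric.complete
  exact ⟨{
    source := hX
    target := CompProb.unitInterval_isComputableProbabilitySpace
    F :=
      { toFun := CompProb.toUnit μ S
        dom := CompProb.core S
        dom_constructive := hS.isConstructiveGδ_core
        dom_full := hS.measure_core
        computableOn := hS.computableOn_toUnit hX hμ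
        measure_preserving := fun _ hA => hS.map_toUnit hX hμ hA }
    G :=
      -- `s 0` is a default value and is never taken as such on `unitCore`.
      { toFun := CompProb.ofUnit μ S (s 0)
        dom := CompProb.unitCore μ S
        dom_constructive := hS.isConstructiveGδ_unitCore hX
        dom_full := hS.volume_unitCore hX hμ
        computableOn := hS.computableOn_ofUnit hX (s 0)
        measure_preserving := fun _ hA => hS.map_ofUnit hX hμ (s 0) hA }
    left_inv := fun _ hx hy => hS.ofUnit_toUnit (s 0) hx hy
    right_inv := fun _ hy hx => hS.toUnit_ofUnit hμ (s 0) hy hx }⟩
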